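/- Let $N\ge 4$, $\kappa>0$, $\epsilon\in\{1,-1\}$. Let $D\subseteq\mathbb R^{N-1}$ be open, with coordinates $x=(x^1,\dots,x^{N-1})$, let $J\subseteq\mathbb R$ be open, with coordinate $y$, and let $V:D\to\mathbb R$ be a function and $\hat h=\hat h_{ij}(x)\,dx^i dx^j$ a symmetric tensor field on $D$, such that $$\hat g=g[V,\hat h]=\epsilon e^{2V(x)}dy^2+e^{-2V(x)}\hat h_{ij}(x)\,dx^i dx^j$$ is a pseudo-Riemannian metric on $J\times D$ (Lorentzian, or of any other fixed signature), where $V$ and the components of $\hat g$ are of class $C^k$ for some $k\ge 2$ (including $k=\infty$ and analytic). Suppose that $\hat g$ solves the vacuum Einstein equations with $\Lambda=0$, that is, $R_{\mu\nu}[\hat g]-\tfrac12\hat g_{\mu\nu}R[\hat g]=0$. Let $\alpha\in[-1,1]$, $\gamma=\alpha+\frac{N-4}{N-3}(1-\alpha)$, and let $\sigma$ be either of $\pm\sqrt{\frac{N-2}{\kappa(N-3)}(1-\alpha^2)}$. Then $$ds^2[g]=\epsilon e^{2\alpha V}dy^2+e^{-2\gamma V}\hat h_{ij}\,dx^i dx^j,\qquad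 \phi=\sigma V$$ is a $C^k$ solution on $J\times D$ of the minimally coupled Einstein–scalar field equations with zero potential, $$R_{\mu\nu}[g]-\tfrac12 g_{\mu\nu}R[g]=\kappa\left(\partial_\mu\phi\,\partial_\nu\phi-\tfrac12 g_{\mu\nu}g^{\alpha\beta}\partial_\alpha\phi\,\partial_\beta\phi\right),\qquad \Box_g\phi=0,$$ where $g$ is a pseudo-Riemannian metric of the same signature as $\hat g$. Moreover $g$ is again orthogonal-symmetric: $g=\epsilon e^{2\alpha V}dy^2+e^{-2\alpha V}h_{ij}(x)\,dx^i dx^j$ for some tensor field $h$ on $D$. -/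

import Mathlib

noncomputable section

namespace EinsteinScalar

/-- A field of matrices on `ℝ^d`: the components `g_{ab}(x)` of a covariant 2-tensor
in one coordinate system. -/
abbrev TensorField (d : ℕ) : Type := (Fin d → ℝ) → Matrix (Fin d) (Fin d) ℝ

/-- The partial derivative `∂_a f` at `x`. -/
def partialDeriv {d : ℕ} (a : Fin d) (f : (Fin d → ℝ) → ℝ) (x : Fin d → ℝ) : ℝ :=
  fderiv ℝ f x (Pi.single a 1)

/-- `g` is a pseudo-Riemannian metric of class `C^k` on the coordinate domain `Ω`, with index `ν`
(the number of negative squares): Lorentzian signature is `ν = 1`, Euclidean is `ν = 0`. -/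
def IsMetricOn {d : ℕ} (k : WithTop ℕ∞) (ν : ℕ) (Ω : Set (Fin d → ℝ)) (g : TensorField d) : Prop :=
  (∀ a b, ContDiffOn ℝ k (fun x => g x a b) Ω) ∧
    ∀ x ∈ Ω, (g x).IsSymm ∧ (g x).det ≠ 0 ∧ sigNeg (g x).toQuadraticForm' = ν

/-- The Christoffel symbols
`Γ^a_{bc} = ½ g^{ae} (∂_b g_{ec} + ∂_c g_{eb} - ∂_e g_{bc})` of the Levi-Civita connection. -/
def christoffel {d : ℕ} (g : TensorField d) (a b c : Fin d) (x : Fin d → ℝ) : ℝ :=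
  (1 / 2) * ∑ e, (g x)⁻¹ a e *
    (partialDeriv b (fun z => g z e c) x + partialDeriv c (fun z => g z e b) x
      - partialDeriv e (fun z => g z b c) x)

/-- The Ricci tensor
`R_{bc} = ∂_a Γ^a_{bc} - ∂_c Γ^a_{ab} + Γ^a_{ae} Γ^e_{bc} - Γ^a_{ce} Γ^e_{ab}`. -/
def ricci {d : ℕ} (g : TensorField d) (b c : Fin d) (x : Fin d → ℝ) : ℝ :=
  ∑ a, partialDeriv a (christoffel g a b c) x
    - ∑ a, partialDeriv c (christoffel g a a b) x
    + ∑ a, ∑ e, christoffel g a a e x * christoffel g e b c x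
    - ∑ a, ∑ e, christoffel g a c e x * christoffel g e a b x

/-- The scalar curvature `R = g^{ab} R_{ab}`. -/
def scalarCurvature {d : ℕ} (g : TensorField d) (x : Fin d → ℝ) : ℝ :=
  ∑ a, ∑ b, (g x)⁻¹ a b * ricci g a b x

/-- The Einstein tensor `R_{ab} - ½ g_{ab} R`. -/
def einsteinTensor {d : ℕ} (g : TensorField d) (a b : Fin d) (x : Fin d → ℝ) : ℝ :=
  ricci g a b x - (1 / 2) * g x a b * scalarCurvature g x

/-- `g^{ab} ∂_a φ ∂_b φ`. -/
def gradSq {d : ℕ} (g : TensorField d) (φ : (Fin d → ℝ) → ℝ) (x : Fin d → ℝ) : ℝ :=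
  ∑ a, ∑ b, (g x)⁻¹ a b * (partialDeriv a φ x * partialDeriv b φ x)

/-- The d'Alembert (Laplace) operator
`□ φ = g^{ab} ∇_a ∇_b φ = g^{ab} (∂_a ∂_b φ - Γ^c_{ab} ∂_c φ)`. -/
def box {d : ℕ} (g : TensorField d) (φ : (Fin d → ℝ) → ℝ) (x : Fin d → ℝ) : ℝ :=
  ∑ a, ∑ b, (g x)⁻¹ a b *
    (partialDeriv a (partialDeriv b φ) x - ∑ c, christoffel g c a b x * partialDeriv c φ x)

/-- `g` is a `C^k` metric of index `ν` on `Ω` that solves the vacuum Einstein equations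
`R_{ab} - ½ g_{ab} R + Λ g_{ab} = 0` there. -/
def IsVacuumSolution {d : ℕ} (k : WithTop ℕ∞) (ν : ℕ) (Ω : Set (Fin d → ℝ)) (Λ : ℝ)
    (g : TensorField d) : Prop :=
  IsMetricOn k ν Ω g ∧ ∀ x ∈ Ω, ∀ a b, einsteinTensor g a b x + Λ * g x a b = 0

/-- `(g, φ)` is a `C^k` solution on `Ω` of the minimally coupled Einstein-scalar field equations
with coupling constant `κ` and effective potential `W`:
`R_{ab} - ½ g_{ab} R = κ (∂_a φ ∂_b φ - ½ g_{ab} g^{ce} ∂_c φ ∂_e φ - g_{ab} W(φ))` and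
`□ φ - W'(φ) = 0`. -/
def IsEinsteinScalarSolution {d : ℕ} (k : WithTop ℕ∞) (ν : ℕ) (Ω : Set (Fin d → ℝ)) (κ : ℝ)
    (W : ℝ → ℝ) (g : TensorField d) (φ : (Fin d → ℝ) → ℝ) : Prop :=
  IsMetricOn k ν Ω g ∧ ContDiffOn ℝ k φ Ω ∧
    (∀ x ∈ Ω, ∀ a b, einsteinTensor g a b x =
      κ * (partialDeriv a φ x * partialDeriv b φ x - (1 / 2) * g x a b * gradSq g φ x
        - g x a b * W (φ x))) ∧
    ∀ x ∈ Ω, box g φ x - deriv W (φ x) = 0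

/-- The metric `p(x) dy² + q_{ij}(x) dx^i dx^j` on `ℝ × ℝ^n` with coordinates
`z = (y, x)`, `y = z 0`, `x = Fin.tail z`. -/
def blockMetric {n : ℕ} (p : (Fin n → ℝ) → ℝ) (q : TensorField n) : TensorField (n + 1) :=
  fun z => Matrix.of (Fin.cons (Fin.cons (p (Fin.tail z)) fun _ => 0)
    fun i => Fin.cons 0 fun j => q (Fin.tail z) i j)

/-- The orthogonal-symmetric metric `g[U, h] = ε e^{2U} dy² + e^{-2U} h_{ij} dx^i dx^j`. -/
def orthMetric {n : ℕ} (ε : ℝ) (U : (Fin n → ℝ) → ℝ) (h : TensorField n) : TensorField (n + 1) :=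
  blockMetric (fun x => ε * Real.exp (2 * U x)) (fun x => Real.exp (-2 * U x) • h x)

/-- The coordinate domain `{(y, x) : y ∈ J, x ∈ D}`. -/
def cylinder {n : ℕ} (J : Set ℝ) (D : Set (Fin n → ℝ)) : Set (Fin (n + 1) → ℝ) :=
  {z | z 0 ∈ J ∧ Fin.tail z ∈ D}

end EinsteinScalar

end

open EinsteinScalar

open EinsteinScalar

/-! Write $n=N-1$ and consider the two-parameter family $\epsilon e^{2aV}dy^2+e^{2bV}h_{ij}dx^idx^j$
(`scaledMetric`), which contains both the given metric, at $(a,b)=(1,-1)$, and the claimed one, at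
$(\alpha,-\gamma)$. Put $s=a+(n-2)b$ and $E=\Delta_hV+s|\nabla V|_h^2$. Its Ricci tensor has no
mixed components, and $R_{yy}=-\epsilon a\,e^{2(a-b)V}E$,
$R_{jk}=R_{jk}[h]-s\nabla_j\nabla_kV+(-a^2+2ab+(n-2)b^2)\,\partial_jV\partial_kV-b\,h_{jk}E$, while
$\Box(\sigma V)=\sigma e^{-2bV}E$.

The exponent $\gamma$ is chosen so that $s$, hence also $E$, is the same for both metrics. Vacuum in
dimension $N\neq2$ means Ricci flat; since $a=1\ne0$ there, $R_{yy}=0$ forces $E=0$. For the new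
metric this gives the wave equation and $R_{yy}=0$, and its $R_{jk}$ differs from the vanishing one
of the old metric only in the coefficient of $\partial_jV\partial_kV$. The value of $\sigma^2$ makes
this difference equal to $\kappa\sigma^2$, so
$R_{\mu\nu}=\kappa\,\partial_\mu\phi\,\partial_\nu\phi$, which is the trace-reversed field equation.

The curvature formulas are `ricci_scaledMetric_zero_zero`, `ricci_scaledMetric_succ_succ` and
`box_scaledMetric`; `isEinsteinScalarSolution_scaledMetric` combines them. -/

namespace EinsteinScalar

/-! ### Coordinate partial derivatives. -/

section Calculus

variable {d : ℕ} {f g : (Fin d → ℝ) → ℝ} {x : Fin d → ℝ} (a : Fin d)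

theorem partialDeriv_congr (h : f =ᶠ[nhds x] g) : partialDeriv a f x = partialDeriv a g x := by
  simp only [partialDeriv, h.fderiv_eq]

theorem partialDeriv_const (c : ℝ) : partialDeriv a (fun _ => c) x = 0 := by
  simp [partialDeriv]

theorem partialDeriv_add (hf : DifferentiableAt ℝ f x) (hg : DifferentiableAt ℝ g x) :
    partialDeriv a (fun z => f z + g z) x = partialDeriv a f x + partialDeriv a g x := by
  simp [partialDeriv, fderiv_fun_add hf hg]

theorem partialDeriv_sub (hf : DifferentiableAt ℝ f x) (hg : DifferentiableAt ℝ g x) :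
    partialDeriv a (fun z => f z - g z) x = partialDeriv a f x - partialDeriv a g x := by
  simp [partialDeriv, fderiv_fun_sub hf hg]

theorem partialDeriv_mul (hf : DifferentiableAt ℝ f x) (hg : DifferentiableAt ℝ g x) :
    partialDeriv a (fun z => f z * g z) x
      = partialDeriv a f x * g x + f x * partialDeriv a g x := by
  simp [partialDeriv, fderiv_fun_mul hf hg]
  ring

theorem partialDeriv_const_mul (c : ℝ) (hf : DifferentiableAt ℝ f x) :
    partialDeriv a (fun z => c * f z) x = c * partialDeriv a f x := by
  simp [partialDeriv, fderiv_const_mul hf]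

theorem partialDeriv_sum {ι : Type*} {s : Finset ι} {F : ι → (Fin d → ℝ) → ℝ}
    (hF : ∀ i ∈ s, DifferentiableAt ℝ (F i) x) :
    partialDeriv a (fun z => ∑ i ∈ s, F i z) x = ∑ i ∈ s, partialDeriv a (F i) x := by
  simp [partialDeriv, fderiv_fun_sum hF]

theorem partialDeriv_exp (hf : DifferentiableAt ℝ f x) :
    partialDeriv a (fun z => Real.exp (f z)) x = Real.exp (f x) * partialDeriv a f x := by
  simp [partialDeriv, fderiv_exp hf]

variable {D : Set (Fin d → ℝ)}

theorem differentiableAt_of_contDiffOn {k : WithTop ℕ∞} (hk : k ≠ 0) (hD : IsOpen D)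
    (hf : ContDiffOn ℝ k f D) (hx : x ∈ D) : DifferentiableAt ℝ f x :=
  (hf.contDiffAt (hD.mem_nhds hx)).differentiableAt hk

theorem differentiableAt_partialDeriv (hD : IsOpen D) (hf : ContDiffOn ℝ 2 f D) (hx : x ∈ D) :
    DifferentiableAt ℝ (partialDeriv a f) x := by
  have h1 : ContDiffOn ℝ 1 (fderiv ℝ f) D := hf.fderiv_of_isOpen hD (by norm_num)
  have h2 := (h1.contDiffAt (hD.mem_nhds hx)).differentiableAt one_ne_zero
  exact h2.clm_apply (differentiableAt_const _)

theorem partialDeriv_comm (b : Fin d) (hD : IsOpen D) (hf : ContDiffOn ℝ 2 f D) (hx : x ∈ D) :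
    partialDeriv a (partialDeriv b f) x = partialDeriv b (partialDeriv a f) x := by
  have h1 : ContDiffOn ℝ 1 (fderiv ℝ f) D := hf.fderiv_of_isOpen hD (by norm_num)
  have h2 := (h1.contDiffAt (hD.mem_nhds hx)).differentiableAt one_ne_zero
  have h3 : IsSymmSndFDerivAt ℝ f x :=
    (hf.contDiffAt (hD.mem_nhds hx)).isSymmSndFDerivAt (by simp)
  have key : ∀ i j : Fin d, partialDeriv i (partialDeriv j f) x
      = fderiv ℝ (fderiv ℝ f) x (Pi.single i 1) (Pi.single j 1) := by
    intro i j
    have : partialDeriv j f = fun z => fderiv ℝ f z (Pi.single j 1) := rfl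
    rw [this, partialDeriv, fderiv_clm_apply h2 (differentiableAt_const _)]
    simp
  rw [key, key]
  exact h3 _ _

end Calculus

/-! ### Functions independent of the coordinate $y$. -/

section Tail

variable {n : ℕ} {f : (Fin n → ℝ) → ℝ} {z : Fin (n + 1) → ℝ}

/-- `Fin.tail` on real vectors as a continuous linear map. -/
def tailCLM (n : ℕ) : (Fin (n + 1) → ℝ) →L[ℝ] (Fin n → ℝ) :=
  ContinuousLinearMap.pi fun i => ContinuousLinearMap.proj i.succ

theorem tailCLM_apply (z : Fin (n + 1) → ℝ) : tailCLM n z = Fin.tail z := rfl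

theorem contDiff_tail {k : WithTop ℕ∞} :
    ContDiff ℝ k (Fin.tail : (Fin (n + 1) → ℝ) → (Fin n → ℝ)) :=
  (tailCLM n).contDiff

theorem fderiv_comp_tail (hf : DifferentiableAt ℝ f (Fin.tail z)) :
    fderiv ℝ (fun w : Fin (n + 1) → ℝ => f (Fin.tail w)) z
      = (fderiv ℝ f (Fin.tail z)).comp (tailCLM n) := by
  have h : HasFDerivAt f (fderiv ℝ f (Fin.tail z)) (tailCLM n z) := hf.hasFDerivAt
  exact (h.comp z (tailCLM n).hasFDerivAt).fderiv

theorem partialDeriv_zero_comp_tail (hf : DifferentiableAt ℝ f (Fin.tail z)) :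
    partialDeriv 0 (fun w : Fin (n + 1) → ℝ => f (Fin.tail w)) z = 0 := by
  have : tailCLM n (Pi.single 0 1) = 0 := by
    ext i
    simp [tailCLM_apply, Fin.tail]
  simp [partialDeriv, fderiv_comp_tail hf, this]

theorem partialDeriv_succ_comp_tail (j : Fin n) (hf : DifferentiableAt ℝ f (Fin.tail z)) :
    partialDeriv j.succ (fun w : Fin (n + 1) → ℝ => f (Fin.tail w)) z
      = partialDeriv j f (Fin.tail z) := by
  have : tailCLM n (Pi.single j.succ 1) = Pi.single j 1 := by
    ext i
    simp [tailCLM_apply, Fin.tail, Pi.single_apply]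
  simp [partialDeriv, fderiv_comp_tail hf, this]

end Tail

/-! ### Differentiability of the inverse metric. -/

section MatrixField

variable {n : ℕ} {h : TensorField n} {x : Fin n → ℝ}

theorem differentiableAt_det (hh : ∀ i j, DifferentiableAt ℝ (fun x => h x i j) x) :
    DifferentiableAt ℝ (fun x => (h x).det) x := by
  simp only [Matrix.det_apply']
  exact DifferentiableAt.fun_sum fun σ _ =>
    (HasFDerivAt.finsetProd fun i _ => (hh (σ i) i).hasFDerivAt).differentiableAt.const_mul _

/-- By Cramer's rule each entry of the inverse is a quotient of determinants of matrices with
differentiable entries. -/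
theorem differentiableAt_inv_apply (hh : ∀ i j, DifferentiableAt ℝ (fun x => h x i j) x)
    (hdet : (h x).det ≠ 0) (i j : Fin n) :
    DifferentiableAt ℝ (fun x => (h x)⁻¹ i j) x := by
  have h1 : ∀ x, (h x)⁻¹ i j
      = ((h x).det)⁻¹ * ((h x).updateRow j (Pi.single i 1)).det := by
    intro x
    rw [Matrix.inv_def, Ring.inverse_eq_inv', Matrix.smul_apply, Matrix.adjugate_apply,
      smul_eq_mul]
  simp only [h1]
  refine ((differentiableAt_det hh).inv hdet).mul
    (differentiableAt_det (h := fun x => (h x).updateRow j (Pi.single i 1)) fun a b => ?_)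
  by_cases ha : a = j
  · simp [ha, Matrix.updateRow_self]
  · simpa [Matrix.updateRow_apply, ha] using hh a b

end MatrixField

/-! ### Determinant and inverse of a block metric. -/

section Block

variable {n : ℕ} (p : (Fin n → ℝ) → ℝ) (q : TensorField n) (z : Fin (n + 1) → ℝ)

@[simp] theorem blockMetric_zero_zero : blockMetric p q z 0 0 = p (Fin.tail z) := rfl
@[simp] theorem blockMetric_zero_succ (j : Fin n) : blockMetric p q z 0 j.succ = 0 := rfl
@[simp] theorem blockMetric_succ_zero (i : Fin n) : blockMetric p q z i.succ 0 = 0 := rfl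
@[simp] theorem blockMetric_succ_succ (i j : Fin n) :
    blockMetric p q z i.succ j.succ = q (Fin.tail z) i j := rfl

theorem det_blockMetric : (blockMetric p q z).det = p (Fin.tail z) * (q (Fin.tail z)).det := by
  rw [Matrix.det_succ_row_zero, Fin.sum_univ_succ]
  simp only [blockMetric_zero_zero, blockMetric_zero_succ]
  have : (blockMetric p q z).submatrix Fin.succ Fin.succ = q (Fin.tail z) := by
    ext i j
    simp
  simp [this]

variable {p q z}

theorem inv_blockMetric (hp : p (Fin.tail z) ≠ 0) (hq : (q (Fin.tail z)).det ≠ 0) :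
    (blockMetric p q z)⁻¹ = blockMetric (fun x => (p x)⁻¹) (fun x => (q x)⁻¹) z := by
  apply Matrix.inv_eq_right_inv
  have hqq : q (Fin.tail z) * (q (Fin.tail z))⁻¹ = 1 :=
    Matrix.mul_nonsing_inv _ (isUnit_iff_ne_zero.2 hq)
  ext i j
  refine Fin.cases ?_ (fun i => ?_) i <;> refine Fin.cases ?_ (fun j => ?_) j
  · simp [Matrix.mul_apply, Fin.sum_univ_succ, hp]
  · simp [Matrix.mul_apply, Fin.sum_univ_succ, (Fin.succ_ne_zero _).symm]
  · simp [Matrix.mul_apply, Fin.sum_univ_succ, Fin.succ_ne_zero]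
  · have := congrFun (congrFun hqq i) j
    simpa [Matrix.mul_apply, Fin.sum_univ_succ, Matrix.one_apply] using this

end Block

/-- Rescaling the coordinates by nonzero factors preserves the index. -/
theorem sigNeg_toQuadraticForm'_diagonal_congr {d : ℕ} {A B : Matrix (Fin d) (Fin d) ℝ}
    {c : Fin d → ℝ} (hc : ∀ i, c i ≠ 0) (hAB : ∀ i j, B i j = c i * c j * A i j) :
    sigNeg B.toQuadraticForm' = sigNeg A.toQuadraticForm' := by
  refine QuadraticMap.Equivalent.sigNeg_eq
    ⟨⟨LinearEquiv.piCongrRight fun i => LinearEquiv.smulOfNeZero ℝ ℝ (c i) (hc i), ?_⟩⟩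
  intro v
  simp only [Matrix.toQuadraticForm', LinearMap.BilinMap.toQuadraticMap_apply,
    Matrix.toLinearMap₂'_apply]
  refine Finset.sum_congr rfl fun i _ => Finset.sum_congr rfl fun j _ => ?_
  simp [hAB]
  ring

/-- `h` is a nondegenerate symmetric tensor field of class `C²` on the open set `D`. -/
structure IsRegularOn {n : ℕ} (D : Set (Fin n → ℝ)) (h : TensorField n) : Prop where
  isOpen : IsOpen D
  contDiffOn : ∀ i j, ContDiffOn ℝ 2 (fun x => h x i j) D
  isSymm : ∀ x ∈ D, (h x).IsSymm
  det_ne_zero : ∀ x ∈ D, (h x).det ≠ 0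

/-- The gradient `h^{il} ∂_l f`. -/
noncomputable def gradient {n : ℕ} (h : TensorField n) (f : (Fin n → ℝ) → ℝ) (i : Fin n) (x : Fin n → ℝ) : ℝ :=
  ∑ l, (h x)⁻¹ i l * partialDeriv l f x

/-! ### The Levi-Civita connection of $h$ and its conformal change. -/

section Regular

variable {n : ℕ} {D : Set (Fin n → ℝ)} {h : TensorField n} {x : Fin n → ℝ}

theorem IsRegularOn.differentiableAt (hh : IsRegularOn D h) (hx : x ∈ D) (i j : Fin n) :
    DifferentiableAt ℝ (fun x => h x i j) x :=
  differentiableAt_of_contDiffOn two_ne_zero hh.isOpen (hh.contDiffOn i j) hx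

theorem IsRegularOn.symm_apply (hh : IsRegularOn D h) (hx : x ∈ D) (i j : Fin n) :
    h x i j = h x j i :=
  (hh.isSymm x hx).apply j i

theorem IsRegularOn.partialDeriv_symm (hh : IsRegularOn D h) (hx : x ∈ D) (a i j : Fin n) :
    partialDeriv a (fun x => h x i j) x = partialDeriv a (fun x => h x j i) x :=
  partialDeriv_congr a
    (Filter.eventually_of_mem (hh.isOpen.mem_nhds hx) fun _ hy => hh.symm_apply hy i j)

theorem IsRegularOn.sum_mul_inv (hh : IsRegularOn D h) (hx : x ∈ D) (i j : Fin n) :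
    ∑ l, h x i l * (h x)⁻¹ l j = if i = j then 1 else 0 := by
  have := Matrix.mul_nonsing_inv _ (isUnit_iff_ne_zero.2 (hh.det_ne_zero x hx))
  simpa [Matrix.mul_apply, Matrix.one_apply] using congrFun (congrFun this i) j

theorem IsRegularOn.sum_inv_mul (hh : IsRegularOn D h) (hx : x ∈ D) (i j : Fin n) :
    ∑ l, (h x)⁻¹ i l * h x l j = if i = j then 1 else 0 := by
  have := Matrix.nonsing_inv_mul _ (isUnit_iff_ne_zero.2 (hh.det_ne_zero x hx))
  simpa [Matrix.mul_apply, Matrix.one_apply] using congrFun (congrFun this i) j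

/-- Lowering an index that was raised with the inverse metric. -/
theorem IsRegularOn.sum_lower (hh : IsRegularOn D h) (hx : x ∈ D) (v : Fin n → ℝ) (i : Fin n) :
    ∑ l, h x i l * ∑ m, (h x)⁻¹ l m * v m = v i := by
  simp only [Finset.mul_sum, ← mul_assoc]
  rw [Finset.sum_comm]
  simp only [← Finset.sum_mul, hh.sum_mul_inv hx]
  simp

theorem IsRegularOn.sum_gradient (hh : IsRegularOn D h) (hx : x ∈ D) (f : (Fin n → ℝ) → ℝ)
    (i : Fin n) : ∑ l, h x i l * gradient h f l x = partialDeriv i f x :=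
  hh.sum_lower hx _ i

theorem IsRegularOn.christoffel_symm (hh : IsRegularOn D h) (hx : x ∈ D) (i j k : Fin n) :
    christoffel h i j k x = christoffel h i k j x := by
  unfold christoffel
  congr 1
  refine Finset.sum_congr rfl fun l _ => ?_
  rw [hh.partialDeriv_symm hx l j k]
  ring

theorem IsRegularOn.sum_christoffel (hh : IsRegularOn D h) (hx : x ∈ D) (i j k : Fin n) :
    ∑ m, h x i m * christoffel h m j k x
      = (1 / 2) * (partialDeriv j (fun z => h z i k) x + partialDeriv k (fun z => h z i j) x
        - partialDeriv i (fun z => h z j k) x) := by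
  rw [← hh.sum_lower hx (fun i => partialDeriv j (fun z => h z i k) x
    + partialDeriv k (fun z => h z i j) x - partialDeriv i (fun z => h z j k) x) i,
    Finset.mul_sum]
  refine Finset.sum_congr rfl fun m _ => ?_
  unfold christoffel
  ring

/-- The Levi-Civita connection is metric. -/
theorem IsRegularOn.partialDeriv_metric (hh : IsRegularOn D h) (hx : x ∈ D) (i j k : Fin n) :
    partialDeriv i (fun z => h z j k) x
      = ∑ m, h x j m * christoffel h m i k x + ∑ m, h x k m * christoffel h m i j x := by
  rw [hh.sum_christoffel hx, hh.sum_christoffel hx, hh.partialDeriv_symm hx i k j,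
    hh.partialDeriv_symm hx j i k, hh.partialDeriv_symm hx k i j]
  ring

theorem IsRegularOn.differentiableAt_inv (hh : IsRegularOn D h) (hx : x ∈ D) (i j : Fin n) :
    DifferentiableAt ℝ (fun x => (h x)⁻¹ i j) x :=
  differentiableAt_inv_apply (hh.differentiableAt hx) (hh.det_ne_zero x hx) i j

theorem IsRegularOn.differentiableAt_christoffel (hh : IsRegularOn D h) (hx : x ∈ D)
    (i j k : Fin n) : DifferentiableAt ℝ (christoffel h i j k) x := by
  have hp := fun a i j => differentiableAt_partialDeriv a hh.isOpen (hh.contDiffOn i j) hx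
  exact (DifferentiableAt.fun_sum fun l _ => (hh.differentiableAt_inv hx i l).mul
    (((hp j l k).add (hp k l j)).sub (hp l j k))).const_mul _

theorem IsRegularOn.differentiableAt_gradient (hh : IsRegularOn D h) {f : (Fin n → ℝ) → ℝ}
    (hf : ContDiffOn ℝ 2 f D) (hx : x ∈ D) (i : Fin n) :
    DifferentiableAt ℝ (gradient h f i) x :=
  DifferentiableAt.fun_sum fun l _ => (hh.differentiableAt_inv hx i l).mul
    (differentiableAt_partialDeriv l hh.isOpen hf hx)

theorem inv_smul_exp {V : (Fin n → ℝ) → ℝ} (hdet : (h x).det ≠ 0) (c : ℝ) :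
    (Real.exp (c * V x) • h x)⁻¹ = (Real.exp (c * V x))⁻¹ • (h x)⁻¹ := by
  refine Matrix.inv_eq_left_inv ?_
  rw [Matrix.smul_mul, Matrix.mul_smul, smul_smul, inv_mul_cancel₀ (Real.exp_pos _).ne',
    one_smul, Matrix.nonsing_inv_mul _ (isUnit_iff_ne_zero.2 hdet)]

/-- The behaviour of the Christoffel symbols under a conformal change of the metric. -/
theorem IsRegularOn.christoffel_conformal (hh : IsRegularOn D h) {V : (Fin n → ℝ) → ℝ}
    (hV : ContDiffOn ℝ 2 V D) (hx : x ∈ D) (b : ℝ) (i j k : Fin n) :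
    christoffel (fun x => Real.exp (2 * b * V x) • h x) i j k x
      = christoffel h i j k x
        + b * ((if i = j then 1 else 0) * partialDeriv k V x
          + (if i = k then 1 else 0) * partialDeriv j V x - h x j k * gradient h V i x) := by
  have hVd : DifferentiableAt ℝ V x := differentiableAt_of_contDiffOn two_ne_zero hh.isOpen hV hx
  have hE : DifferentiableAt ℝ (fun x => 2 * b * V x) x := hVd.const_mul _
  have hd : ∀ a l m, partialDeriv a (fun z => Real.exp (2 * b * V z) * h z l m) x
      = Real.exp (2 * b * V x)
        * (2 * b * partialDeriv a V x * h x l m + partialDeriv a (fun z => h z l m) x) := by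
    intro a l m
    rw [partialDeriv_mul a hE.exp (hh.differentiableAt hx l m), partialDeriv_exp a hE,
      partialDeriv_const_mul a _ hVd]
    ring
  have hinv : (Real.exp (2 * b * V x) • h x)⁻¹ = (Real.exp (2 * b * V x))⁻¹ • (h x)⁻¹ :=
    inv_smul_exp (hh.det_ne_zero x hx) _
  -- Writing the Kronecker deltas as $h^{il}h_{lj}$ and $h^{il}h_{lk}$ turns both sides into sums
  -- over the same $l$, which agree term by term.
  rw [← hh.sum_inv_mul hx i j, ← hh.sum_inv_mul hx i k]
  simp only [christoffel, hd, hinv, gradient, Matrix.smul_apply, smul_eq_mul, Finset.mul_sum,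
    Finset.sum_mul, ← Finset.sum_add_distrib, ← Finset.sum_sub_distrib]
  refine Finset.sum_congr rfl fun l _ => ?_
  field_simp
  ring

end Regular

/-! ### Christoffel symbols of a $y$-independent block metric. -/

section BlockChristoffel

variable {n : ℕ} {p : (Fin n → ℝ) → ℝ} {q : TensorField n} {z : Fin (n + 1) → ℝ}

theorem partialDeriv_blockMetric_zero (hp : DifferentiableAt ℝ p (Fin.tail z))
    (hq : ∀ i j, DifferentiableAt ℝ (fun x => q x i j) (Fin.tail z)) (a b : Fin (n + 1)) :
    partialDeriv 0 (fun w => blockMetric p q w a b) z = 0 := by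
  refine Fin.cases ?_ (fun i => ?_) a <;> refine Fin.cases ?_ (fun j => ?_) b
  · exact partialDeriv_zero_comp_tail hp
  · exact partialDeriv_const _ _
  · exact partialDeriv_const _ _
  · exact partialDeriv_zero_comp_tail (hq i j)

theorem christoffel_blockMetric_zero_zero_zero
    (hp : DifferentiableAt ℝ p (Fin.tail z))
    (hp0 : p (Fin.tail z) ≠ 0) (hq : ∀ i j, DifferentiableAt ℝ (fun x => q x i j) (Fin.tail z))
    (hq0 : (q (Fin.tail z)).det ≠ 0) :
    christoffel (blockMetric p q) 0 0 0 z = 0 := by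
  simp only [christoffel, Fin.sum_univ_succ, inv_blockMetric hp0 hq0,
    partialDeriv_blockMetric_zero hp hq]
  simp

theorem christoffel_blockMetric_zero_zero_succ
    (hp : DifferentiableAt ℝ p (Fin.tail z))
    (hp0 : p (Fin.tail z) ≠ 0) (hq : ∀ i j, DifferentiableAt ℝ (fun x => q x i j) (Fin.tail z))
    (hq0 : (q (Fin.tail z)).det ≠ 0) (j : Fin n) :
    christoffel (blockMetric p q) 0 0 j.succ z
      = (1 / 2) * ((p (Fin.tail z))⁻¹ * partialDeriv j p (Fin.tail z)) := by
  simp only [christoffel, Fin.sum_univ_succ, inv_blockMetric hp0 hq0,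
    partialDeriv_blockMetric_zero hp hq]
  simp [partialDeriv_succ_comp_tail j hp]

theorem christoffel_blockMetric_zero_succ_zero
    (hp : DifferentiableAt ℝ p (Fin.tail z))
    (hp0 : p (Fin.tail z) ≠ 0) (hq : ∀ i j, DifferentiableAt ℝ (fun x => q x i j) (Fin.tail z))
    (hq0 : (q (Fin.tail z)).det ≠ 0) (j : Fin n) :
    christoffel (blockMetric p q) 0 j.succ 0 z
      = (1 / 2) * ((p (Fin.tail z))⁻¹ * partialDeriv j p (Fin.tail z)) := by
  simp only [christoffel, Fin.sum_univ_succ, inv_blockMetric hp0 hq0,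
    partialDeriv_blockMetric_zero hp hq]
  simp [partialDeriv_succ_comp_tail j hp]

theorem christoffel_blockMetric_zero_succ_succ
    (hp : DifferentiableAt ℝ p (Fin.tail z))
    (hp0 : p (Fin.tail z) ≠ 0) (hq : ∀ i j, DifferentiableAt ℝ (fun x => q x i j) (Fin.tail z))
    (hq0 : (q (Fin.tail z)).det ≠ 0) (i j : Fin n) :
    christoffel (blockMetric p q) 0 i.succ j.succ z = 0 := by
  simp only [christoffel, Fin.sum_univ_succ, inv_blockMetric hp0 hq0,
    partialDeriv_blockMetric_zero hp hq]
  simp [partialDeriv_const]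

theorem christoffel_blockMetric_succ_zero_zero
    (hp : DifferentiableAt ℝ p (Fin.tail z))
    (hp0 : p (Fin.tail z) ≠ 0) (hq : ∀ i j, DifferentiableAt ℝ (fun x => q x i j) (Fin.tail z))
    (hq0 : (q (Fin.tail z)).det ≠ 0) (i : Fin n) :
    christoffel (blockMetric p q) i.succ 0 0 z
      = -(1 / 2) * ∑ l, (q (Fin.tail z))⁻¹ i l * partialDeriv l p (Fin.tail z) := by
  simp only [christoffel, Fin.sum_univ_succ, inv_blockMetric hp0 hq0,
    partialDeriv_blockMetric_zero hp hq]
  simp [partialDeriv_succ_comp_tail _ hp]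

theorem christoffel_blockMetric_succ_zero_succ
    (hp : DifferentiableAt ℝ p (Fin.tail z))
    (hp0 : p (Fin.tail z) ≠ 0) (hq : ∀ i j, DifferentiableAt ℝ (fun x => q x i j) (Fin.tail z))
    (hq0 : (q (Fin.tail z)).det ≠ 0) (i j : Fin n) :
    christoffel (blockMetric p q) i.succ 0 j.succ z = 0 := by
  simp only [christoffel, Fin.sum_univ_succ, inv_blockMetric hp0 hq0,
    partialDeriv_blockMetric_zero hp hq]
  simp [partialDeriv_const]

theorem christoffel_blockMetric_succ_succ_zero
    (hp : DifferentiableAt ℝ p (Fin.tail z))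
    (hp0 : p (Fin.tail z) ≠ 0) (hq : ∀ i j, DifferentiableAt ℝ (fun x => q x i j) (Fin.tail z))
    (hq0 : (q (Fin.tail z)).det ≠ 0) (i j : Fin n) :
    christoffel (blockMetric p q) i.succ j.succ 0 z = 0 := by
  simp only [christoffel, Fin.sum_univ_succ, inv_blockMetric hp0 hq0,
    partialDeriv_blockMetric_zero hp hq]
  simp [partialDeriv_const]

theorem christoffel_blockMetric_succ_succ_succ
    (hp0 : p (Fin.tail z) ≠ 0) (hq : ∀ i j, DifferentiableAt ℝ (fun x => q x i j) (Fin.tail z))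
    (hq0 : (q (Fin.tail z)).det ≠ 0) (i j k : Fin n) :
    christoffel (blockMetric p q) i.succ j.succ k.succ z = christoffel q i j k (Fin.tail z) := by
  simp only [christoffel, Fin.sum_univ_succ, inv_blockMetric hp0 hq0]
  simp [fun a i j => partialDeriv_succ_comp_tail a (hq i j)]

end BlockChristoffel

/-- The metric `ε e^{2aV} dy² + e^{2bV} h_{ij} dx^i dx^j`. -/
noncomputable def scaledMetric {n : ℕ} (ε a b : ℝ) (V : (Fin n → ℝ) → ℝ) (h : TensorField n) :
    TensorField (n + 1) :=
  blockMetric (fun x => ε * Real.exp (2 * a * V x)) (fun x => Real.exp (2 * b * V x) • h x)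

/-- The spatial Christoffel symbols of `scaledMetric`. -/
noncomputable def conformalChristoffel {n : ℕ} (b : ℝ) (V : (Fin n → ℝ) → ℝ) (h : TensorField n)
    (i j k : Fin n) (x : Fin n → ℝ) : ℝ :=
  christoffel h i j k x
    + b * ((if i = j then 1 else 0) * partialDeriv k V x
      + (if i = k then 1 else 0) * partialDeriv j V x - h x j k * gradient h V i x)

/-! ### Contractions with the conformal difference tensor. -/

section Algebra

variable {n : ℕ} {h : Fin n → Fin n → ℝ} {v W : Fin n → ℝ}

/-- Up to the factor $b$, the bracket is the difference $C^i_{kl}$ between the Christoffel symbols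
of $e^{2bV}h$ and of $h$, with $v=dV$ and $W=\nabla V$. Leaving `A` arbitrary covers both the mixed
terms $\Gamma C$ and the square $CC$ in the Ricci tensor. -/
theorem sum_sum_mul_conformal (A : Fin n → Fin n → ℝ) (k : Fin n) :
    ∑ i, ∑ l, A i l * ((if i = k then 1 else 0) * v l + (if i = l then 1 else 0) * v k
        - h k l * W i)
      = ∑ l, A k l * v l + v k * ∑ i, A i i - ∑ i, W i * ∑ l, h k l * A i l := by
  have h1 : ∑ i, ∑ l, A i l * ((if i = k then 1 else 0) * v l) = ∑ l, A k l * v l := by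
    rw [Finset.sum_comm]
    simp
  have h2 : ∑ i, ∑ l, A i l * ((if i = l then 1 else 0) * v k) = v k * ∑ i, A i i := by
    rw [Finset.mul_sum]
    refine Finset.sum_congr rfl fun i _ => ?_
    simp [mul_comm]
  have h3 : ∑ i, ∑ l, A i l * (h k l * W i) = ∑ i, W i * ∑ l, h k l * A i l := by
    simp only [Finset.mul_sum]
    refine Finset.sum_congr rfl fun i _ => Finset.sum_congr rfl fun l _ => ?_
    ring
  rw [← h1, ← h2, ← h3]
  simp only [mul_sub, mul_add, Finset.sum_add_distrib, Finset.sum_sub_distrib]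

theorem sum_mul_conformal (u : Fin n → ℝ) (j k : Fin n) :
    ∑ l, u l * ((if l = j then 1 else 0) * v k + (if l = k then 1 else 0) * v j - h j k * W l)
      = u j * v k + u k * v j - h j k * ∑ l, u l * W l := by
  simp only [mul_sub, mul_add, Finset.sum_add_distrib, Finset.sum_sub_distrib, Finset.mul_sum]
  congr 1
  · simp
  · exact Finset.sum_congr rfl fun l _ => by ring

theorem trace_conformal (hW : ∀ i, ∑ l, h i l * W l = v i) (hs : ∀ i j, h i j = h j i)
    (j : Fin n) :
    ∑ i, ((if i = i then 1 else 0) * v j + (if i = j then 1 else 0) * v i - h i j * W i)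
      = n * v j := by
  have : ∑ i, h i j * W i = v j := by
    rw [← hW j]
    exact Finset.sum_congr rfl fun i _ => by rw [hs]
  simp [Finset.sum_add_distrib, Finset.sum_sub_distrib, this]

/-- This is $C^i_{kl}C^l_{ij}$. In the coefficient $n+2$, the $n$ is the trace $C^i_{ij}=n\,v_j$ and
the $2$ comes from contracting $C$ with $v$. -/
theorem sum_conformal_mul_conformal (hW : ∀ i, ∑ l, h i l * W l = v i)
    (hs : ∀ i j, h i j = h j i) (j k : Fin n) :
    ∑ i, ∑ l, ((if l = i then 1 else 0) * v j + (if l = j then 1 else 0) * v i - h i j * W l)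
        * ((if i = k then 1 else 0) * v l + (if i = l then 1 else 0) * v k - h k l * W i)
      = (n + 2) * (v j * v k) - 2 * h j k * ∑ l, v l * W l := by
  rw [sum_sum_mul_conformal (fun i l => (if l = i then 1 else 0) * v j
    + (if l = j then 1 else 0) * v i - h i j * W l) k]
  have h1 : ∑ l, ((if l = k then 1 else 0) * v j + (if l = j then 1 else 0) * v k - h k j * W l)
      * v l = 2 * (v j * v k) - h j k * ∑ l, v l * W l := by
    rw [show 2 * (v j * v k) - h j k * ∑ l, v l * W l
        = v k * v j + v j * v k - h k j * ∑ l, v l * W l by rw [hs k j]; ring,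
      ← sum_mul_conformal]
    exact Finset.sum_congr rfl fun l _ => by ring
  have h2 : ∀ i, ∑ l, h k l * ((if l = i then 1 else 0) * v j + (if l = j then 1 else 0) * v i
      - h i j * W l) = h k i * v j + h k j * v i - h i j * v k := fun i => by
    rw [sum_mul_conformal (fun l => h k l), hW]
  have h3 : ∑ i, W i * (h k i * v j + h k j * v i - h i j * v k) = h j k * ∑ l, v l * W l := by
    have e : ∀ i, W i * (h k i * v j + h k j * v i - h i j * v k)
        = (h k i * W i) * v j + h j k * (v i * W i) - (h j i * W i) * v k := fun i => by
      rw [hs k j, hs i j]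
      ring
    simp only [e, Finset.sum_add_distrib, Finset.sum_sub_distrib, ← Finset.sum_mul,
      ← Finset.mul_sum, hW]
    ring
  rw [h1, trace_conformal hW hs]
  simp only [h2, h3]
  ring

/-- The terms quadratic in the Christoffel symbols of the spatial Ricci tensor. -/
theorem sum_christoffel_mul_christoffel (hW : ∀ i, ∑ l, h i l * W l = v i)
    (hs : ∀ i j, h i j = h j i) (Γ : Fin n → Fin n → Fin n → ℝ)
    (hΓ : ∀ i j k, Γ i j k = Γ i k j) (b : ℝ) (j k : Fin n) :
    ∑ i, ∑ l, (Γ i k l + b * ((if i = k then 1 else 0) * v l + (if i = l then 1 else 0) * v k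
        - h k l * W i))
      * (Γ l i j + b * ((if l = i then 1 else 0) * v j + (if l = j then 1 else 0) * v i
        - h i j * W l))
      = ∑ i, ∑ l, Γ i k l * Γ l i j
        + b * (2 * ∑ l, Γ l j k * v l + v k * ∑ i, Γ i i j + v j * ∑ i, Γ i i k
          - ∑ i, W i * (∑ l, h k l * Γ l i j + ∑ l, h j l * Γ l i k))
        + b ^ 2 * ((n + 2) * (v j * v k) - 2 * h j k * ∑ l, v l * W l) := by
  rw [← sum_conformal_mul_conformal hW hs]
  -- The part linear in $b$ consists of two contractions of $\Gamma$ with $C$, one with free index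
  -- $k$ and one with free index $j$. In the second the roles of $i$ and $l$ are exchanged, hence
  -- the swapped order of summation.
  have h1 := sum_sum_mul_conformal (h := h) (v := v) (W := W) (fun i l => Γ l i j) k
  have h2 := sum_sum_mul_conformal (h := h) (v := v) (W := W) (fun l i => Γ i k l) j
  rw [Finset.sum_comm] at h2
  have e : b * (2 * ∑ l, Γ l j k * v l + v k * ∑ i, Γ i i j + v j * ∑ i, Γ i i k
        - ∑ i, W i * (∑ l, h k l * Γ l i j + ∑ l, h j l * Γ l i k))
      = b * ((∑ l, Γ l k j * v l + v k * ∑ i, Γ i i j - ∑ i, W i * ∑ l, h k l * Γ l i j)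
        + (∑ l, Γ l k j * v l + v j * ∑ i, Γ i k i - ∑ i, W i * ∑ l, h j l * Γ l k i)) := by
    have e1 : ∀ l, Γ l k j = Γ l j k := fun l => hΓ l k j
    have e2 : ∀ l, Γ l k l = Γ l l k := fun l => hΓ l k l
    have e3 : ∀ l i, Γ l k i = Γ l i k := fun l i => hΓ l k i
    simp only [e1, e2, mul_add, Finset.sum_add_distrib]
    simp only [e3]
    ring
  rw [e, ← h1, ← h2]
  simp only [← Finset.sum_add_distrib, Finset.mul_sum]
  refine Finset.sum_congr rfl fun i _ => Finset.sum_congr rfl fun l _ => ?_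
  rw [hs i j]
  ring

end Algebra

/-! ### Christoffel symbols of the two-parameter family, and the Laplacian of $h$. -/

section Scaled

variable {n : ℕ} {D : Set (Fin n → ℝ)} {h : TensorField n} {V : (Fin n → ℝ) → ℝ} {ε a b : ℝ}
  {x : Fin n → ℝ} {z : Fin (n + 1) → ℝ}

theorem differentiableAt_exp_mul (c : ℝ) (hV : DifferentiableAt ℝ V x) :
    DifferentiableAt ℝ (fun x => Real.exp (c * V x)) x :=
  (hV.const_mul c).exp

theorem partialDeriv_exp_mul (c : ℝ) (hV : DifferentiableAt ℝ V x) (j : Fin n) :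
    partialDeriv j (fun x => Real.exp (c * V x)) x
      = c * Real.exp (c * V x) * partialDeriv j V x := by
  rw [partialDeriv_exp j (hV.const_mul c), partialDeriv_const_mul j c hV]
  ring

theorem det_smul_exp_ne_zero (hdet : (h x).det ≠ 0) (c : ℝ) :
    (Real.exp (c * V x) • h x).det ≠ 0 := by
  rw [Matrix.det_smul]
  exact mul_ne_zero (pow_ne_zero _ (Real.exp_pos _).ne') hdet

/-- The Christoffel symbols of `scaledMetric`. -/
theorem christoffel_scaledMetric (hh : IsRegularOn D h) (hV : ContDiffOn ℝ 2 V D) (hε : ε ≠ 0)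
    (a b : ℝ) (hz : Fin.tail z ∈ D) :
    christoffel (scaledMetric ε a b V h) 0 0 0 z = 0 ∧
    (∀ j, christoffel (scaledMetric ε a b V h) 0 0 j.succ z
      = a * partialDeriv j V (Fin.tail z)) ∧
    (∀ j, christoffel (scaledMetric ε a b V h) 0 j.succ 0 z
      = a * partialDeriv j V (Fin.tail z)) ∧
    (∀ j k, christoffel (scaledMetric ε a b V h) 0 (Fin.succ j) (Fin.succ k) z = 0) ∧
    (∀ i, christoffel (scaledMetric ε a b V h) (Fin.succ i) 0 0 z
      = -(ε * a) * (Real.exp (2 * (a - b) * V (Fin.tail z)) * gradient h V i (Fin.tail z))) ∧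
    (∀ i j, christoffel (scaledMetric ε a b V h) (Fin.succ i) 0 (Fin.succ j) z = 0) ∧
    (∀ i j, christoffel (scaledMetric ε a b V h) (Fin.succ i) (Fin.succ j) 0 z = 0) ∧
    (∀ i j k, christoffel (scaledMetric ε a b V h) (Fin.succ i) (Fin.succ j) (Fin.succ k) z
      = conformalChristoffel b V h i j k (Fin.tail z)) := by
  have hVd : DifferentiableAt ℝ V (Fin.tail z) :=
    differentiableAt_of_contDiffOn two_ne_zero hh.isOpen hV hz
  have hp : DifferentiableAt ℝ (fun x => ε * Real.exp (2 * a * V x)) (Fin.tail z) :=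
    (differentiableAt_exp_mul _ hVd).const_mul _
  have hdp : ∀ j, partialDeriv j (fun x => ε * Real.exp (2 * a * V x)) (Fin.tail z)
      = ε * (2 * a * Real.exp (2 * a * V (Fin.tail z)) * partialDeriv j V (Fin.tail z)) := by
    intro j
    rw [partialDeriv_const_mul j _ (differentiableAt_exp_mul _ hVd), partialDeriv_exp_mul _ hVd]
  have hp0 : ε * Real.exp (2 * a * V (Fin.tail z)) ≠ 0 := mul_ne_zero hε (Real.exp_pos _).ne'
  have hq : ∀ i j, DifferentiableAt ℝ (fun x => (Real.exp (2 * b * V x) • h x) i j)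
      (Fin.tail z) := fun i j => (differentiableAt_exp_mul _ hVd).mul (hh.differentiableAt hz i j)
  have hq0 := det_smul_exp_ne_zero (V := V) (hh.det_ne_zero _ hz) (2 * b)
  have h00j : ∀ j, (1 / 2) * ((ε * Real.exp (2 * a * V (Fin.tail z)))⁻¹
      * partialDeriv j (fun x => ε * Real.exp (2 * a * V x)) (Fin.tail z))
      = a * partialDeriv j V (Fin.tail z) := by
    intro j
    rw [hdp]
    field_simp
  refine ⟨christoffel_blockMetric_zero_zero_zero hp hp0 hq hq0,
    fun j => (christoffel_blockMetric_zero_zero_succ hp hp0 hq hq0 j).trans (h00j j),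
    fun j => (christoffel_blockMetric_zero_succ_zero hp hp0 hq hq0 j).trans (h00j j),
    christoffel_blockMetric_zero_succ_succ hp hp0 hq hq0, fun i => ?_,
    christoffel_blockMetric_succ_zero_succ hp hp0 hq hq0,
    christoffel_blockMetric_succ_succ_zero hp hp0 hq hq0,
    fun i j k => (christoffel_blockMetric_succ_succ_succ hp0 hq hq0 i j k).trans
      (hh.christoffel_conformal hV hz b i j k)⟩
  refine (christoffel_blockMetric_succ_zero_zero hp hp0 hq hq0 i).trans ?_
  rw [inv_smul_exp (hh.det_ne_zero _ hz),
    show 2 * (a - b) * V (Fin.tail z) = 2 * a * V (Fin.tail z) - 2 * b * V (Fin.tail z) by ring,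
    Real.exp_sub, gradient, Finset.mul_sum, Finset.mul_sum, Finset.mul_sum]
  refine Finset.sum_congr rfl fun l _ => ?_
  rw [hdp, Matrix.smul_apply, smul_eq_mul]
  field_simp

/-- The formulas for the Christoffel symbols hold only over $D$. Its preimage under `Fin.tail` is
open, so they hold near `z` and may be differentiated there. -/
theorem partialDeriv_zero_of_eqOn_tail (hD : IsOpen D) (hz : Fin.tail z ∈ D)
    {F : (Fin (n + 1) → ℝ) → ℝ} {f : (Fin n → ℝ) → ℝ} (hf : DifferentiableAt ℝ f (Fin.tail z))
    (hF : ∀ w : Fin (n + 1) → ℝ, Fin.tail w ∈ D → F w = f (Fin.tail w)) :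
    partialDeriv 0 F z = 0 :=
  (partialDeriv_congr 0 (Filter.eventually_of_mem
    ((hD.preimage (tailCLM n).continuous).mem_nhds hz) hF)).trans (partialDeriv_zero_comp_tail hf)

theorem partialDeriv_succ_of_eqOn_tail (hD : IsOpen D) (hz : Fin.tail z ∈ D)
    {F : (Fin (n + 1) → ℝ) → ℝ} {f : (Fin n → ℝ) → ℝ} (hf : DifferentiableAt ℝ f (Fin.tail z))
    (hF : ∀ w : Fin (n + 1) → ℝ, Fin.tail w ∈ D → F w = f (Fin.tail w)) (m : Fin n) :
    partialDeriv m.succ F z = partialDeriv m f (Fin.tail z) :=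
  (partialDeriv_congr _ (Filter.eventually_of_mem
    ((hD.preimage (tailCLM n).continuous).mem_nhds hz) hF)).trans (partialDeriv_succ_comp_tail m hf)

theorem differentiableAt_conformalChristoffel (hh : IsRegularOn D h) (hV : ContDiffOn ℝ 2 V D)
    (b : ℝ) (hx : x ∈ D) (i j k : Fin n) :
    DifferentiableAt ℝ (conformalChristoffel b V h i j k) x := by
  have hVk := fun k => differentiableAt_partialDeriv k hh.isOpen hV hx
  exact (hh.differentiableAt_christoffel hx i j k).add
    (((((hVk k).const_mul _).add ((hVk j).const_mul _)).sub
      ((hh.differentiableAt hx j k).mul (hh.differentiableAt_gradient hV hx i))).const_mul b)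

theorem partialDeriv_conformalChristoffel (hh : IsRegularOn D h) (hV : ContDiffOn ℝ 2 V D)
    (b : ℝ) (hx : x ∈ D) (m i j k : Fin n) :
    partialDeriv m (conformalChristoffel b V h i j k) x
      = partialDeriv m (christoffel h i j k) x
        + b * ((if i = j then 1 else 0) * partialDeriv m (partialDeriv k V) x
          + (if i = k then 1 else 0) * partialDeriv m (partialDeriv j V) x
          - (partialDeriv m (fun x => h x j k) x * gradient h V i x
            + h x j k * partialDeriv m (gradient h V i) x)) := by
  have hVk := fun k => differentiableAt_partialDeriv k hh.isOpen hV hx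
  have hG := hh.differentiableAt_gradient hV hx i
  have hhd := hh.differentiableAt hx j k
  have h1 := (hVk k).const_mul (if i = j then (1 : ℝ) else 0)
  have h2 := (hVk j).const_mul (if i = k then (1 : ℝ) else 0)
  have h12 := h1.fun_add h2
  have h3 := hhd.fun_mul hG
  have h4 := h12.fun_sub h3
  unfold conformalChristoffel
  rw [partialDeriv_add m (hh.differentiableAt_christoffel hx i j k) (h4.const_mul b),
    partialDeriv_const_mul m b h4, partialDeriv_sub m h12 h3, partialDeriv_add m h1 h2,
    partialDeriv_const_mul m _ (hVk k), partialDeriv_const_mul m _ (hVk j),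
    partialDeriv_mul m hhd hG]

/-- The derivative of `V_j = h_{ij} W^i`. -/
theorem IsRegularOn.partialDeriv_lower_gradient (hh : IsRegularOn D h)
    (hV : ContDiffOn ℝ 2 V D) (hx : x ∈ D) (m j : Fin n) :
    ∑ i, (partialDeriv m (fun x => h x i j) x * gradient h V i x
        + h x i j * partialDeriv m (gradient h V i) x)
      = partialDeriv m (partialDeriv j V) x := by
  have h1 : partialDeriv m (partialDeriv j V) x
      = partialDeriv m (fun x => ∑ i, h x i j * gradient h V i x) x := by
    refine partialDeriv_congr m (Filter.eventually_of_mem (hh.isOpen.mem_nhds hx) fun y hy => ?_)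
    change _ = ∑ i, h y i j * gradient h V i y
    rw [← hh.sum_gradient hy V j]
    exact Finset.sum_congr rfl fun i _ => by rw [hh.symm_apply hy]
  rw [h1, partialDeriv_sum m fun i _ =>
    (hh.differentiableAt hx i j).fun_mul (hh.differentiableAt_gradient hV hx i)]
  exact Finset.sum_congr rfl fun i _ =>
    (partialDeriv_mul m (hh.differentiableAt hx i j) (hh.differentiableAt_gradient hV hx i)).symm

/-- The Laplacian is the divergence of the gradient. -/
theorem IsRegularOn.box_eq_divergence (hh : IsRegularOn D h) (hV : ContDiffOn ℝ 2 V D)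
    (hx : x ∈ D) :
    box h V x = ∑ i, partialDeriv i (gradient h V i) x
      + ∑ l, (∑ i, christoffel h i i l x) * gradient h V l x := by
  -- Substituting $\partial_iV=h_{il}W^l$ into the Hessian leaves only derivatives of $h$ and $W$,
  -- so the inverse metric is never differentiated. The terms without $\partial W$ assemble into a
  -- Christoffel symbol with lowered index, contracted with $W$.
  have h1 : ∀ k i, partialDeriv k (partialDeriv i V) x
      - ∑ c, christoffel h c k i x * partialDeriv c V x
      = ∑ l, h x i l * partialDeriv k (gradient h V l) x
        + ∑ l, (1 / 2) * (partialDeriv k (fun z => h z i l) x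
          + partialDeriv l (fun z => h z i k) x - partialDeriv i (fun z => h z k l) x)
          * gradient h V l x := by
    intro k i
    have h2 : ∑ c, christoffel h c k i x * partialDeriv c V x
        = ∑ l, (1 / 2) * (partialDeriv k (fun z => h z l i) x
          + partialDeriv i (fun z => h z l k) x - partialDeriv l (fun z => h z k i) x)
          * gradient h V l x := by
      simp only [← hh.sum_christoffel hx, ← hh.sum_gradient hx V, Finset.mul_sum, Finset.sum_mul]
      rw [Finset.sum_comm]
      refine Finset.sum_congr rfl fun l _ => Finset.sum_congr rfl fun c _ => ?_
      rw [hh.symm_apply hx c l]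
      ring
    rw [h2, ← hh.partialDeriv_lower_gradient hV hx, ← Finset.sum_sub_distrib,
      ← Finset.sum_add_distrib]
    refine Finset.sum_congr rfl fun l _ => ?_
    rw [hh.symm_apply hx l i, hh.partialDeriv_symm hx k l i, hh.partialDeriv_symm hx i l k,
      hh.partialDeriv_symm hx l k i]
    ring
  have h3 : ∑ k, ∑ i, (h x)⁻¹ k i * ∑ l, h x i l * partialDeriv k (gradient h V l) x
      = ∑ i, partialDeriv i (gradient h V i) x := by
    refine Finset.sum_congr rfl fun k _ => ?_
    simp only [Finset.mul_sum, ← mul_assoc]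
    rw [Finset.sum_comm]
    simp only [← Finset.sum_mul, hh.sum_inv_mul hx]
    simp
  simp only [box, h1, mul_add, Finset.sum_add_distrib, h3]
  congr 1
  simp only [christoffel, Finset.mul_sum, Finset.sum_mul]
  rw [eq_comm, Finset.sum_comm]
  refine Finset.sum_congr rfl fun k _ => ?_
  rw [Finset.sum_comm]
  exact Finset.sum_congr rfl fun i _ => Finset.sum_congr rfl fun l _ => by ring

end Scaled

/-! ### Ricci tensor and wave operator of the two-parameter family. -/

section Curvature

variable {n : ℕ} {D : Set (Fin n → ℝ)} {h : TensorField n} {V : (Fin n → ℝ) → ℝ} {ε : ℝ}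
  {x : Fin n → ℝ} {z : Fin (n + 1) → ℝ}

theorem gradSq_eq_sum_gradient :
    gradSq h V x = ∑ l, partialDeriv l V x * gradient h V l x := by
  simp only [gradSq, gradient, Finset.mul_sum]
  exact Finset.sum_congr rfl fun i _ => Finset.sum_congr rfl fun j _ => by ring

/-- Partial derivatives of the Christoffel symbols of `scaledMetric`. -/
theorem partialDeriv_christoffel_scaledMetric (hh : IsRegularOn D h) (hV : ContDiffOn ℝ 2 V D)
    (hε : ε ≠ 0) (a b : ℝ) (hz : Fin.tail z ∈ D) :
    (∀ i j k, partialDeriv 0 (christoffel (scaledMetric ε a b V h) i j k) z = 0) ∧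
    (∀ m j, partialDeriv (Fin.succ m) (christoffel (scaledMetric ε a b V h) 0 0 (Fin.succ j)) z
      = a * partialDeriv m (partialDeriv j V) (Fin.tail z)) ∧
    (∀ m j, partialDeriv (Fin.succ m) (christoffel (scaledMetric ε a b V h) 0 (Fin.succ j) 0) z
      = a * partialDeriv m (partialDeriv j V) (Fin.tail z)) ∧
    (∀ m, partialDeriv (Fin.succ m) (christoffel (scaledMetric ε a b V h) 0 0 0) z = 0) ∧
    (∀ m i, partialDeriv (Fin.succ m) (christoffel (scaledMetric ε a b V h) (Fin.succ i) 0 0) z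
      = -(ε * a) * (Real.exp (2 * (a - b) * V (Fin.tail z))
        * (2 * (a - b) * (partialDeriv m V (Fin.tail z) * gradient h V i (Fin.tail z))
          + partialDeriv m (gradient h V i) (Fin.tail z)))) ∧
    (∀ m i j, partialDeriv (Fin.succ m)
      (christoffel (scaledMetric ε a b V h) (Fin.succ i) 0 (Fin.succ j)) z = 0) ∧
    (∀ m i j, partialDeriv (Fin.succ m)
      (christoffel (scaledMetric ε a b V h) (Fin.succ i) (Fin.succ j) 0) z = 0) ∧
    (∀ m i j k, partialDeriv (Fin.succ m)
      (christoffel (scaledMetric ε a b V h) (Fin.succ i) (Fin.succ j) (Fin.succ k)) z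
      = partialDeriv m (conformalChristoffel b V h i j k) (Fin.tail z)) := by
  have hC := fun (w : Fin (n + 1) → ℝ) (hw : Fin.tail w ∈ D) =>
    christoffel_scaledMetric hh hV hε a b hw
  have hVd : DifferentiableAt ℝ V (Fin.tail z) :=
    differentiableAt_of_contDiffOn two_ne_zero hh.isOpen hV hz
  have hVj := fun j => differentiableAt_partialDeriv j hh.isOpen hV hz
  have haV := fun j => (hVj j).const_mul a
  have hG := fun i => hh.differentiableAt_gradient hV hz i
  have hE := differentiableAt_exp_mul (2 * (a - b)) hVd
  have hEG := fun i => (hE.fun_mul (hG i))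
  have hEG' := fun i => (hEG i).const_mul (-(ε * a))
  have hK := fun i j k => differentiableAt_conformalChristoffel hh hV b hz i j k
  have h0 : DifferentiableAt ℝ (fun _ : Fin n → ℝ => (0 : ℝ)) (Fin.tail z) :=
    differentiableAt_const _
  have zero {F : (Fin (n + 1) → ℝ) → ℝ} {f : (Fin n → ℝ) → ℝ}
      (hf : DifferentiableAt ℝ f (Fin.tail z))
      (hF : ∀ w : Fin (n + 1) → ℝ, Fin.tail w ∈ D → F w = f (Fin.tail w)) :=
    partialDeriv_zero_of_eqOn_tail hh.isOpen hz hf hF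
  have succ {F : (Fin (n + 1) → ℝ) → ℝ} {f : (Fin n → ℝ) → ℝ}
      (hf : DifferentiableAt ℝ f (Fin.tail z))
      (hF : ∀ w : Fin (n + 1) → ℝ, Fin.tail w ∈ D → F w = f (Fin.tail w)) (m : Fin n) :=
    partialDeriv_succ_of_eqOn_tail hh.isOpen hz hf hF m
  refine ⟨fun i j k => ?_, fun m j => ?_, fun m j => ?_, fun m => ?_, fun m i => ?_,
    fun m i j => ?_, fun m i j => ?_, fun m i j k => ?_⟩
  · refine Fin.cases ?_ (fun i => ?_) i <;> refine Fin.cases ?_ (fun j => ?_) j <;>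
      refine Fin.cases ?_ (fun k => ?_) k
    · exact zero h0 fun w hw => (hC w hw).1
    · exact zero (haV k) fun w hw => (hC w hw).2.1 k
    · exact zero (haV j) fun w hw => (hC w hw).2.2.1 j
    · exact zero h0 fun w hw => (hC w hw).2.2.2.1 j k
    · exact zero (hEG' i) fun w hw => (hC w hw).2.2.2.2.1 i
    · exact zero h0 fun w hw => (hC w hw).2.2.2.2.2.1 i k
    · exact zero h0 fun w hw => (hC w hw).2.2.2.2.2.2.1 i j
    · exact zero (hK i j k) fun w hw => (hC w hw).2.2.2.2.2.2.2 i j k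
  · exact (succ (haV j) (fun w hw => (hC w hw).2.1 j) m).trans (partialDeriv_const_mul m a (hVj j))
  · exact (succ (haV j) (fun w hw => (hC w hw).2.2.1 j) m).trans
      (partialDeriv_const_mul m a (hVj j))
  · exact (succ h0 (fun w hw => (hC w hw).1) m).trans (partialDeriv_const m 0)
  · rw [succ (hEG' i) (fun w hw => (hC w hw).2.2.2.2.1 i) m, partialDeriv_const_mul m _ (hEG i),
      partialDeriv_mul m hE (hG i), partialDeriv_exp_mul _ hVd]
    ring
  · exact (succ h0 (fun w hw => (hC w hw).2.2.2.2.2.1 i j) m).trans (partialDeriv_const m 0)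
  · exact (succ h0 (fun w hw => (hC w hw).2.2.2.2.2.2.1 i j) m).trans (partialDeriv_const m 0)
  · exact succ (hK i j k) (fun w hw => (hC w hw).2.2.2.2.2.2.2 i j k) m

theorem sum_conformalChristoffel_trace (hh : IsRegularOn D h) (hx : x ∈ D) (b : ℝ) (l : Fin n) :
    ∑ i, conformalChristoffel b V h i i l x
      = ∑ i, christoffel h i i l x + b * (n * partialDeriv l V x) := by
  rw [← trace_conformal (h := h x) (hh.sum_gradient hx V) (hh.symm_apply hx) l]
  simp only [conformalChristoffel, Finset.sum_add_distrib, Finset.mul_sum]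

theorem sum_mul_conformalChristoffel (b : ℝ) (u : Fin n → ℝ) (j k : Fin n) :
    ∑ l, u l * conformalChristoffel b V h l j k x
      = ∑ l, u l * christoffel h l j k x
        + b * (u j * partialDeriv k V x + u k * partialDeriv j V x
          - h x j k * ∑ l, u l * gradient h V l x) := by
  rw [← sum_mul_conformal (h := h x) (v := fun i => partialDeriv i V x)
    (W := fun i => gradient h V i x), Finset.mul_sum, ← Finset.sum_add_distrib]
  exact Finset.sum_congr rfl fun l _ => by
    unfold conformalChristoffel
    ring

/-- The last factor is the expression that must vanish in vacuum when `a ≠ 0`; it depends on the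
exponents only through $a+(n-2)b$. -/
theorem ricci_scaledMetric_zero_zero (hh : IsRegularOn D h) (hV : ContDiffOn ℝ 2 V D)
    (hε : ε ≠ 0) (a b : ℝ) (hz : Fin.tail z ∈ D) :
    ricci (scaledMetric ε a b V h) 0 0 z
      = -(ε * a) * Real.exp (2 * (a - b) * V (Fin.tail z))
        * (box h V (Fin.tail z) + (a + (n - 2) * b) * gradSq h V (Fin.tail z)) := by
  obtain ⟨c1, c2, c3, c4, c5, c6, c7, c8⟩ := christoffel_scaledMetric hh hV hε a b hz
  obtain ⟨d1, d2, d3, d4, d5, d6, d7, d8⟩ :=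
    partialDeriv_christoffel_scaledMetric hh hV hε a b hz
  simp only [ricci, Fin.sum_univ_succ, c1, c2, c3, c5, c6, c7, c8, d1, d5]
  rw [hh.box_eq_divergence hV hz, gradSq_eq_sum_gradient]
  set y := Fin.tail z
  have e : ∑ i, ∑ l, conformalChristoffel b V h i i l y
      * (-(ε * a) * (Real.exp (2 * (a - b) * V y) * gradient h V l y))
      = -(ε * a) * Real.exp (2 * (a - b) * V y)
        * (∑ l, (∑ i, christoffel h i i l y) * gradient h V l y
          + b * n * ∑ l, partialDeriv l V y * gradient h V l y) := by
    rw [Finset.sum_comm]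
    simp only [← Finset.sum_mul, sum_conformalChristoffel_trace hh hz]
    rw [Finset.mul_sum _ _ (b * n), ← Finset.sum_add_distrib, Finset.mul_sum]
    exact Finset.sum_congr rfl fun l _ => by ring
  have e1 : ∑ l, a * partialDeriv l V y
      * (-(ε * a) * (Real.exp (2 * (a - b) * V y) * gradient h V l y))
      = -(ε * a) * Real.exp (2 * (a - b) * V y)
        * (a * ∑ l, partialDeriv l V y * gradient h V l y) := by
    rw [Finset.mul_sum, Finset.mul_sum]
    exact Finset.sum_congr rfl fun l _ => by ring
  have e2 : ∑ l, -(ε * a) * (Real.exp (2 * (a - b) * V y) * gradient h V l y)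
      * (a * partialDeriv l V y)
      = -(ε * a) * Real.exp (2 * (a - b) * V y)
        * (a * ∑ l, partialDeriv l V y * gradient h V l y) := by
    rw [Finset.mul_sum, Finset.mul_sum]
    exact Finset.sum_congr rfl fun l _ => by ring
  simp only [Finset.sum_add_distrib, Finset.sum_const_zero, mul_zero, add_zero,
    zero_add, e, e1, e2, ← Finset.mul_sum]
  ring

theorem ricci_scaledMetric_zero_succ (hh : IsRegularOn D h) (hV : ContDiffOn ℝ 2 V D)
    (hε : ε ≠ 0) (a b : ℝ) (hz : Fin.tail z ∈ D) (j : Fin n) :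
    ricci (scaledMetric ε a b V h) 0 j.succ z = 0 := by
  obtain ⟨c1, c2, c3, c4, c5, c6, c7, c8⟩ := christoffel_scaledMetric hh hV hε a b hz
  obtain ⟨d1, d2, d3, d4, d5, d6, d7, d8⟩ :=
    partialDeriv_christoffel_scaledMetric hh hV hε a b hz
  simp [ricci, Fin.sum_univ_succ, c1, c2, c3, c4, c5, c6, c7, c8, d1, d4, d6, d7]

theorem ricci_scaledMetric_succ_zero (hh : IsRegularOn D h) (hV : ContDiffOn ℝ 2 V D)
    (hε : ε ≠ 0) (a b : ℝ) (hz : Fin.tail z ∈ D) (j : Fin n) :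
    ricci (scaledMetric ε a b V h) j.succ 0 z = 0 := by
  obtain ⟨c1, c2, c3, c4, c5, c6, c7, c8⟩ := christoffel_scaledMetric hh hV hε a b hz
  obtain ⟨d1, d2, d3, d4, d5, d6, d7, d8⟩ :=
    partialDeriv_christoffel_scaledMetric hh hV hε a b hz
  simp [ricci, Fin.sum_univ_succ, c1, c2, c3, c4, c5, c6, c7, c8, d1, d7]

/-- Grouped so that, once the last factor vanishes and $a+(n-2)b$ is fixed, the exponents survive
only in the coefficient of $\partial_jV\,\partial_kV$. -/
theorem ricci_scaledMetric_succ_succ (hh : IsRegularOn D h) (hV : ContDiffOn ℝ 2 V D)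
    (hε : ε ≠ 0) (a b : ℝ) (hz : Fin.tail z ∈ D) (j k : Fin n) :
    ricci (scaledMetric ε a b V h) j.succ k.succ z
      = ricci h j k (Fin.tail z)
        - (a + (n - 2) * b) * (partialDeriv k (partialDeriv j V) (Fin.tail z)
          - ∑ l, christoffel h l j k (Fin.tail z) * partialDeriv l V (Fin.tail z))
        + (-a ^ 2 + 2 * a * b + (n - 2) * b ^ 2)
          * (partialDeriv j V (Fin.tail z) * partialDeriv k V (Fin.tail z))
        - b * h (Fin.tail z) j k
          * (box h V (Fin.tail z) + (a + (n - 2) * b) * gradSq h V (Fin.tail z)) := by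
  obtain ⟨c1, c2, c3, c4, c5, c6, c7, c8⟩ := christoffel_scaledMetric hh hV hε a b hz
  obtain ⟨d1, d2, d3, d4, d5, d6, d7, d8⟩ :=
    partialDeriv_christoffel_scaledMetric hh hV hε a b hz
  simp only [ricci, Fin.sum_univ_succ, c1, c2, c3, c4, c6, c7, c8, d1, d2, d8]
  rw [hh.box_eq_divergence hV hz, gradSq_eq_sum_gradient]
  set y := Fin.tail z
  -- Metric compatibility rewrites $\partial_ih_{jk}$ through $\Gamma$; the resulting terms cancel
  -- against the mixed terms of `eD`.
  have eA : ∑ i, partialDeriv i (conformalChristoffel b V h i j k) y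
      = ∑ i, partialDeriv i (christoffel h i j k) y
        + b * (2 * partialDeriv k (partialDeriv j V) y
          - ∑ i, gradient h V i y * (∑ l, h y k l * christoffel h l i j y
            + ∑ l, h y j l * christoffel h l i k y)
          - h y j k * ∑ i, partialDeriv i (gradient h V i) y) := by
    simp only [partialDeriv_conformalChristoffel hh hV b hz, hh.partialDeriv_metric hz _ j k,
      Finset.sum_add_distrib, Finset.sum_sub_distrib, ← Finset.mul_sum]
    have s1 : ∑ i, (if i = j then 1 else 0) * partialDeriv i (partialDeriv k V) y
        = partialDeriv k (partialDeriv j V) y := by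
      simp [partialDeriv_comm j k hh.isOpen hV hz]
    have s2 : ∑ i, (if i = k then 1 else 0) * partialDeriv i (partialDeriv j V) y
        = partialDeriv k (partialDeriv j V) y := by simp
    have s3 : ∑ i, gradient h V i y * (∑ l, h y k l * christoffel h l i j y
          + ∑ l, h y j l * christoffel h l i k y)
        = ∑ i, (∑ l, h y j l * christoffel h l i k y + ∑ l, h y k l * christoffel h l i j y)
          * gradient h V i y := Finset.sum_congr rfl fun i _ => by ring
    rw [s1, s2, s3]
    ring
  have eB : ∑ i, partialDeriv k (conformalChristoffel b V h i i j) y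
      = ∑ i, partialDeriv k (christoffel h i i j) y
        + b * (n * partialDeriv k (partialDeriv j V) y) := by
    simp only [partialDeriv_conformalChristoffel hh hV b hz,
      Finset.sum_add_distrib, Finset.sum_sub_distrib, ← Finset.mul_sum]
    -- The derivative of the lowered gradient cancels the second Kronecker term, leaving only the
    -- trace factor $n$.
    rw [← Finset.sum_add_distrib, hh.partialDeriv_lower_gradient hV hz]
    simp
  have hu := fun u => sum_mul_conformalChristoffel (V := V) (h := h) (x := y) b u j k
  have eC : ∑ i, ∑ l, conformalChristoffel b V h i i l y * conformalChristoffel b V h l j k y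
      = ∑ i, ∑ l, christoffel h i i l y * christoffel h l j k y
        + b * ((∑ i, christoffel h i i j y) * partialDeriv k V y
          + (∑ i, christoffel h i i k y) * partialDeriv j V y
          - h y j k * ∑ l, (∑ i, christoffel h i i l y) * gradient h V l y)
        + b * n * ∑ l, partialDeriv l V y * conformalChristoffel b V h l j k y := by
    rw [Finset.sum_comm, Finset.sum_comm (f := fun i l => christoffel h i i l y * _)]
    simp only [← Finset.sum_mul, sum_conformalChristoffel_trace hh hz]
    rw [add_assoc, ← add_assoc, ← hu, Finset.mul_sum, ← Finset.sum_add_distrib]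
    exact Finset.sum_congr rfl fun l _ => by ring
  have eC' : ∑ l, a * partialDeriv l V y * conformalChristoffel b V h l j k y
      = a * ∑ l, partialDeriv l V y * conformalChristoffel b V h l j k y := by
    rw [Finset.mul_sum]
    exact Finset.sum_congr rfl fun l _ => by ring
  have eD := sum_christoffel_mul_christoffel (h := h y) (hh.sum_gradient hz V)
    (hh.symm_apply hz) (fun i j k => christoffel h i j k y)
    (fun i j k => hh.christoffel_symm hz i j k) b j k
  have eD' : ∑ i, ∑ l, conformalChristoffel b V h i k l y * conformalChristoffel b V h l i j y
      = _ := eD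
  have eH : ∑ l, partialDeriv l V y * christoffel h l j k y
      = ∑ l, christoffel h l j k y * partialDeriv l V y :=
    Finset.sum_congr rfl fun l _ => mul_comm _ _
  simp only [Finset.sum_const_zero, mul_zero, add_zero, zero_add, eA, eB, eC, eC', eD', hu fun l => partialDeriv l V y, eH]
  ring

theorem inv_scaledMetric (hh : IsRegularOn D h) (hε : ε ≠ 0) (a b : ℝ) (hz : Fin.tail z ∈ D) :
    (scaledMetric ε a b V h z)⁻¹ 0 0 = ε⁻¹ * (Real.exp (2 * a * V (Fin.tail z)))⁻¹ ∧
    (∀ j, (scaledMetric ε a b V h z)⁻¹ 0 (Fin.succ j) = 0) ∧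
    (∀ i, (scaledMetric ε a b V h z)⁻¹ (Fin.succ i) 0 = 0) ∧
    (∀ i j, (scaledMetric ε a b V h z)⁻¹ (Fin.succ i) (Fin.succ j)
      = (Real.exp (2 * b * V (Fin.tail z)))⁻¹ * (h (Fin.tail z))⁻¹ i j) := by
  have hdet := hh.det_ne_zero _ hz
  have e : (scaledMetric ε a b V h z)⁻¹ = _ :=
    inv_blockMetric (z := z) (p := fun x => ε * Real.exp (2 * a * V x))
      (q := fun x => Real.exp (2 * b * V x) • h x) (mul_ne_zero hε (Real.exp_pos _).ne')
      (det_smul_exp_ne_zero hdet (2 * b))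
  rw [e]
  refine ⟨?_, fun j => rfl, fun i => rfl, fun i j => ?_⟩
  · simp [mul_comm]
  · rw [blockMetric_succ_succ, inv_smul_exp hdet, Matrix.smul_apply, smul_eq_mul]

/-- The factor of $R_{yy}$ reappears, so the wave equation for $\sigma V$ follows from the same
scalar identity. -/
theorem box_scaledMetric (hh : IsRegularOn D h) (hV : ContDiffOn ℝ 2 V D)
    (hε : ε ≠ 0) (a b σ : ℝ) (hz : Fin.tail z ∈ D) :
    box (scaledMetric ε a b V h) (fun w => σ * V (Fin.tail w)) z
      = σ * (Real.exp (2 * b * V (Fin.tail z)))⁻¹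
        * (box h V (Fin.tail z) + (a + (n - 2) * b) * gradSq h V (Fin.tail z)) := by
  obtain ⟨c1, c2, c3, c4, c5, c6, c7, c8⟩ := christoffel_scaledMetric hh hV hε a b hz
  obtain ⟨i1, i2, i3, i4⟩ := inv_scaledMetric (V := V) hh hε a b hz
  have hVd := fun {y : Fin n → ℝ} (hy : y ∈ D) =>
    (differentiableAt_of_contDiffOn two_ne_zero hh.isOpen hV hy).const_mul σ
  have hVj := fun j => differentiableAt_partialDeriv j hh.isOpen hV hz
  have p0 : partialDeriv 0 (fun w : Fin (n + 1) → ℝ => σ * V (Fin.tail w)) z = 0 :=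
    partialDeriv_zero_comp_tail (hVd hz)
  have pj : ∀ (j : Fin n) (w : Fin (n + 1) → ℝ), Fin.tail w ∈ D →
      partialDeriv j.succ (fun w : Fin (n + 1) → ℝ => σ * V (Fin.tail w)) w
        = σ * partialDeriv j V (Fin.tail w) := fun j w hw =>
    (partialDeriv_succ_comp_tail j (hVd hw)).trans (partialDeriv_const_mul j σ
      (differentiableAt_of_contDiffOn two_ne_zero hh.isOpen hV hw))
  have p00 : partialDeriv 0 (partialDeriv 0
      (fun w : Fin (n + 1) → ℝ => σ * V (Fin.tail w))) z = 0 :=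
    partialDeriv_zero_of_eqOn_tail (f := fun _ => 0) hh.isOpen hz (differentiableAt_const _)
      fun w hw => partialDeriv_zero_comp_tail (hVd hw)
  have pij : ∀ i j : Fin n, partialDeriv i.succ (partialDeriv j.succ
      (fun w : Fin (n + 1) → ℝ => σ * V (Fin.tail w))) z
      = σ * partialDeriv i (partialDeriv j V) (Fin.tail z) := fun i j =>
    (partialDeriv_succ_of_eqOn_tail hh.isOpen hz ((hVj j).const_mul σ) (pj j) i).trans
      (partialDeriv_const_mul i σ (hVj j))
  rw [box]
  simp only [Fin.sum_univ_succ, i1, i2, i3, i4, p0, pj _ _ hz, p00, pij, c4, c5, c8]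
  set y := Fin.tail z
  have e0 : ∑ l, -(ε * a) * (Real.exp (2 * (a - b) * V y) * gradient h V l y)
      * (σ * partialDeriv l V y)
      = -(ε * a) * Real.exp (2 * (a - b) * V y) * σ * gradSq h V y := by
    rw [gradSq_eq_sum_gradient, Finset.mul_sum]
    exact Finset.sum_congr rfl fun l _ => by ring
  have e1 : ∀ i j, ∑ l, conformalChristoffel b V h l i j y * (σ * partialDeriv l V y)
      = σ * (∑ l, christoffel h l i j y * partialDeriv l V y
        + b * (2 * (partialDeriv i V y * partialDeriv j V y) - h y i j * gradSq h V y)) := by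
    intro i j
    have := sum_mul_conformalChristoffel (V := V) (h := h) (x := y) b
      (fun l => partialDeriv l V y) i j
    have e2 : ∑ l, christoffel h l i j y * partialDeriv l V y
        = ∑ l, partialDeriv l V y * christoffel h l i j y :=
      Finset.sum_congr rfl fun l _ => mul_comm _ _
    rw [e2, gradSq_eq_sum_gradient,
      show 2 * (partialDeriv i V y * partialDeriv j V y)
        = partialDeriv i V y * partialDeriv j V y + partialDeriv j V y * partialDeriv i V y by ring,
      ← this, Finset.mul_sum]
    exact Finset.sum_congr rfl fun l _ => by ring
  have tr : ∑ i, ∑ j, (h y)⁻¹ i j * h y i j = n := by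
    have : ∀ i, ∑ j, (h y)⁻¹ i j * h y i j = 1 := fun i => by
      rw [← if_pos (c := i = i) (t := (1 : ℝ)) (e := 0) rfl, ← hh.sum_inv_mul hz i i]
      exact Finset.sum_congr rfl fun j _ => by rw [hh.symm_apply hz i j]
    simp [this]
  have e2 : ∑ i, ∑ j, (Real.exp (2 * b * V y))⁻¹ * (h y)⁻¹ i j
      * (σ * partialDeriv i (partialDeriv j V) y
        - σ * (∑ l, christoffel h l i j y * partialDeriv l V y
        + b * (2 * (partialDeriv i V y * partialDeriv j V y) - h y i j * gradSq h V y)))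
      = σ * (Real.exp (2 * b * V y))⁻¹
        * (box h V y - 2 * b * gradSq h V y + b * gradSq h V y * n) := by
    -- One occurrence of $|\nabla V|^2$ is expanded as a double sum while the one multiplying the
    -- trace $n=h^{ij}h_{ij}$ stays a scalar; the identity then holds term by term.
    have hG : gradSq h V y
        = ∑ i, ∑ j, (h y)⁻¹ i j * (partialDeriv i V y * partialDeriv j V y) := rfl
    rw [show 2 * b * gradSq h V y = 2 * b * _ from congrArg _ hG, ← tr]
    generalize gradSq h V y = G
    simp only [box, Finset.mul_sum, ← Finset.sum_sub_distrib, ← Finset.sum_add_distrib]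
    refine Finset.sum_congr rfl fun i _ => Finset.sum_congr rfl fun j _ => ?_
    ring
  simp only [e0, e1, e2, mul_zero, zero_mul, zero_add, add_zero, Finset.sum_const_zero]
  rw [show 2 * (a - b) * V y = 2 * a * V y - 2 * b * V y by ring, Real.exp_sub]
  field_simp
  ring

end Curvature

/-! ### Trace reversal of the field equations. -/

section Trace

variable {d : ℕ} {g : TensorField d} {x : Fin d → ℝ}

theorem sum_inv_mul_self (hs : (g x).IsSymm) (hdet : (g x).det ≠ 0) :
    ∑ a, ∑ b, (g x)⁻¹ a b * g x a b = d := by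
  have h1 := Matrix.nonsing_inv_mul _ (isUnit_iff_ne_zero.2 hdet)
  have : ∀ a, ∑ b, (g x)⁻¹ a b * g x a b = 1 := fun a => by
    have h2 := congrFun (congrFun h1 a) a
    rw [Matrix.mul_apply, Matrix.one_apply_eq] at h2
    rw [← h2]
    exact Finset.sum_congr rfl fun b _ => by rw [hs.apply]
  simp [this]

/-- In dimension other than two, vacuum metrics are Ricci flat. -/
theorem ricci_eq_zero_of_einsteinTensor_eq_zero (hd : (d : ℝ) ≠ 2) (hs : (g x).IsSymm)
    (hdet : (g x).det ≠ 0) (hE : ∀ a b, einsteinTensor g a b x = 0) (a b : Fin d) :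
    ricci g a b x = 0 := by
  have hR : ∀ a b, ricci g a b x = (1 / 2) * g x a b * scalarCurvature g x :=
    fun a b => sub_eq_zero.1 (hE a b)
  -- The trace of $R_{ab}=\tfrac12 g_{ab}R$ is $R=\tfrac d2R$, which forces $R=0$ when $d\ne2$.
  have h1 : scalarCurvature g x = (1 / 2) * scalarCurvature g x * d := by
    rw [← sum_inv_mul_self hs hdet, Finset.mul_sum]
    conv_lhs => rw [scalarCurvature]
    refine Finset.sum_congr rfl fun a _ => ?_
    rw [Finset.mul_sum]
    exact Finset.sum_congr rfl fun b _ => by rw [hR]; ring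
  have h2 : scalarCurvature g x * ((d : ℝ) - 2) = 0 := by linear_combination -2 * h1
  rw [hR, (mul_eq_zero.1 h2).resolve_right (sub_ne_zero.2 hd), mul_zero]

theorem einsteinTensor_of_ricci {κ : ℝ} {φ : (Fin d → ℝ) → ℝ}
    (hR : ∀ a b, ricci g a b x = κ * (partialDeriv a φ x * partialDeriv b φ x)) (a b : Fin d) :
    einsteinTensor g a b x
      = κ * (partialDeriv a φ x * partialDeriv b φ x - (1 / 2) * g x a b * gradSq g φ x) := by
  have h1 : scalarCurvature g x = κ * gradSq g φ x := by
    simp only [scalarCurvature, gradSq, hR, Finset.mul_sum]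
    exact Finset.sum_congr rfl fun a _ => Finset.sum_congr rfl fun b _ => by ring
  rw [einsteinTensor, h1, hR]
  ring

end Trace

/-! ### Changing the exponents of a Ricci-flat metric. -/

section Rescale

variable {n : ℕ} {k : WithTop ℕ∞} {ν : ℕ} {J : Set ℝ} {D : Set (Fin n → ℝ)} {h : TensorField n}
  {V : (Fin n → ℝ) → ℝ} {ε a b : ℝ}

theorem orthMetric_eq_scaledMetric : orthMetric ε V h = scaledMetric ε 1 (-1) V h := by
  simp [orthMetric, scaledMetric]

theorem contDiffOn_comp_tail {f : (Fin n → ℝ) → ℝ} (hf : ContDiffOn ℝ k f D) :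
    ContDiffOn ℝ k (fun z : Fin (n + 1) → ℝ => f (Fin.tail z)) (cylinder J D) :=
  hf.comp contDiff_tail.contDiffOn fun _ hz => hz.2

/-- Changing the exponents of the conformal factors preserves metrics and their index. -/
theorem isMetricOn_scaledMetric (a' b' : ℝ) (hV : ContDiffOn ℝ k V D)
    (hg : IsMetricOn k ν (cylinder J D) (scaledMetric ε a b V h)) :
    IsMetricOn k ν (cylinder J D) (scaledMetric ε a' b' V h) := by
  -- The new matrix is $CgC$ with $C$ the positive diagonal matrix of entries $e^{c_iV}$: a
  -- congruence, so the index is preserved.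
  let c : Fin (n + 1) → ℝ := Fin.cons (a' - a) fun _ => b' - b
  have hmul : ∀ z i j, scaledMetric ε a' b' V h z i j
      = Real.exp (c i * V (Fin.tail z)) * Real.exp (c j * V (Fin.tail z))
        * scaledMetric ε a b V h z i j := by
    intro z i j
    unfold scaledMetric
    refine Fin.cases ?_ (fun i => ?_) i <;> refine Fin.cases ?_ (fun j => ?_) j
    · simp only [blockMetric_zero_zero, c, Fin.cons_zero]
      rw [← Real.exp_add, mul_left_comm, ← Real.exp_add]
      ring_nf
    · simp
    · simp
    · simp only [blockMetric_succ_succ, c, Fin.cons_succ, Matrix.smul_apply, smul_eq_mul]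
      rw [← Real.exp_add, ← mul_assoc, ← Real.exp_add]
      ring_nf
  refine ⟨fun i j => ?_, fun z hz => ?_⟩
  · simp only [hmul]
    have hc : ∀ i, ContDiffOn ℝ k (fun z : Fin (n + 1) → ℝ => Real.exp (c i * V (Fin.tail z)))
        (cylinder J D) := fun i => (contDiffOn_const.mul (contDiffOn_comp_tail hV)).exp
    exact ((hc i).mul (hc j)).mul (hg.1 i j)
  · obtain ⟨hs, hdet, hν⟩ := hg.2 z hz
    refine ⟨Matrix.IsSymm.ext fun i j => ?_, ?_, ?_⟩
    · rw [hmul, hmul, hs.apply]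
      ring
    · unfold scaledMetric at hdet ⊢
      rw [det_blockMetric, Matrix.det_smul] at hdet ⊢
      refine mul_ne_zero (mul_ne_zero ?_ (Real.exp_pos _).ne')
        (mul_ne_zero (pow_ne_zero _ (Real.exp_pos _).ne') ?_)
      · exact left_ne_zero_of_mul (left_ne_zero_of_mul hdet)
      · exact right_ne_zero_of_mul (right_ne_zero_of_mul hdet)
    · rw [← hν]
      exact sigNeg_toQuadraticForm'_diagonal_congr (fun i => (Real.exp_pos _).ne') (hmul z)

/-- Setting the second exponent to $0$ strips the conformal factor, and restricting to a slice $y=t$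
recovers $h$. Over an empty `J` the metric hypothesis would say nothing about $h$. -/
theorem isRegularOn_of_isMetricOn (hk : 2 ≤ k) (hD : IsOpen D) (hJ : J.Nonempty)
    (hV : ContDiffOn ℝ k V D)
    (hg : IsMetricOn k ν (cylinder J D) (scaledMetric ε a b V h)) : IsRegularOn D h := by
  have hg' := isMetricOn_scaledMetric a 0 hV hg
  obtain ⟨t, ht⟩ := hJ
  have htail : ∀ x : Fin n → ℝ, Fin.tail (Fin.cons t x : Fin (n + 1) → ℝ) = x := fun _ => rfl
  have hmem : ∀ x ∈ D, (Fin.cons t x : Fin (n + 1) → ℝ) ∈ cylinder J D := fun x hx =>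
    ⟨ht, (htail x).symm ▸ hx⟩
  have hval : ∀ x i j, scaledMetric ε a 0 V h (Fin.cons t x) i.succ j.succ = h x i j := by
    intro x i j
    simp [scaledMetric, htail]
  have hcons : ContDiff ℝ k (fun x : Fin n → ℝ => (Fin.cons t x : Fin (n + 1) → ℝ)) := by
    refine contDiff_pi.2 fun i => ?_
    refine Fin.cases ?_ (fun i => ?_) i
    · exact contDiff_const
    · exact contDiff_apply ℝ ℝ i
  refine ⟨hD, fun i j => ?_, fun x hx => ?_, fun x hx => ?_⟩
  · have := ((hg'.1 i.succ j.succ).comp hcons.contDiffOn hmem).of_le hk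
    exact this.congr fun x _ => (hval x i j).symm
  · refine Matrix.IsSymm.ext fun i j => ?_
    rw [← hval, ← hval, (hg'.2 _ (hmem x hx)).1.apply]
  · have := (hg'.2 _ (hmem x hx)).2.1
    unfold scaledMetric at this
    rw [det_blockMetric, htail] at this
    simpa using right_ne_zero_of_mul this

/-- The exponents `(a', b')` with `a' + (n - 2) b' = a + (n - 2) b` turn a Ricci flat metric into
an Einstein-scalar solution with `κ σ²` the difference of the quadratic coefficients. -/
theorem isEinsteinScalarSolution_scaledMetric {κ σ a' b' : ℝ} (hk : 2 ≤ k) (hD : IsOpen D)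
    (hε : ε ≠ 0) (hV : ContDiffOn ℝ k V D) (ha : a ≠ 0)
    (hg : IsMetricOn k ν (cylinder J D) (scaledMetric ε a b V h))
    (hR : ∀ z ∈ cylinder J D, ∀ i j, ricci (scaledMetric ε a b V h) i j z = 0)
    (hlin : a' + ((n : ℝ) - 2) * b' = a + ((n : ℝ) - 2) * b)
    (hquad : κ * σ ^ 2 = (-a' ^ 2 + 2 * a' * b' + ((n : ℝ) - 2) * b' ^ 2)
      - (-a ^ 2 + 2 * a * b + ((n : ℝ) - 2) * b ^ 2)) :
    IsEinsteinScalarSolution k ν (cylinder J D) κ (fun _ => 0) (scaledMetric ε a' b' V h)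
      (fun z => σ * V (Fin.tail z)) := by
  have hV2 : ContDiffOn ℝ 2 V D := hV.of_le hk
  -- Regularity of $h$ is derived at each point of the cylinder because that point supplies the
  -- element of `J` it requires. The scalar equation is $R_{yy}=0$ divided by its nonzero prefactor,
  -- which is where `ha` enters.
  have key : ∀ z ∈ cylinder J D, IsRegularOn D h ∧
      box h V (Fin.tail z) + (a + ((n : ℝ) - 2) * b) * gradSq h V (Fin.tail z) = 0 := by
    intro z hz
    have hh := isRegularOn_of_isMetricOn hk hD ⟨z 0, hz.1⟩ hV hg
    refine ⟨hh, ?_⟩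
    have h0 := hR z hz 0 0
    rw [ricci_scaledMetric_zero_zero hh hV2 hε a b hz.2] at h0
    exact (mul_eq_zero.1 h0).resolve_left
      (mul_ne_zero (neg_ne_zero.2 (mul_ne_zero hε ha)) (Real.exp_pos _).ne')
  refine ⟨isMetricOn_scaledMetric a' b' hV hg, contDiffOn_const.mul (contDiffOn_comp_tail hV),
    fun z hz => ?_, fun z hz => ?_⟩
  · obtain ⟨hh, hbox⟩ := key z hz
    have hVd : DifferentiableAt ℝ V (Fin.tail z) :=
      differentiableAt_of_contDiffOn two_ne_zero hD hV2 hz.2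
    have p0 : partialDeriv 0 (fun z : Fin (n + 1) → ℝ => σ * V (Fin.tail z)) z = 0 :=
      partialDeriv_zero_comp_tail (hVd.const_mul σ)
    have pj : ∀ j : Fin n, partialDeriv j.succ (fun z : Fin (n + 1) → ℝ => σ * V (Fin.tail z)) z
        = σ * partialDeriv j V (Fin.tail z) := fun j =>
      (partialDeriv_succ_comp_tail j (hVd.const_mul σ)).trans (partialDeriv_const_mul j σ hVd)
    have hRic : ∀ i j, ricci (scaledMetric ε a' b' V h) i j z
        = κ * (partialDeriv i (fun z => σ * V (Fin.tail z)) z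
          * partialDeriv j (fun z => σ * V (Fin.tail z)) z) := by
      intro i j
      refine Fin.cases ?_ (fun i => ?_) i <;> refine Fin.cases ?_ (fun j => ?_) j
      · rw [ricci_scaledMetric_zero_zero hh hV2 hε _ _ hz.2, hlin, hbox, p0]
        ring
      · rw [ricci_scaledMetric_zero_succ hh hV2 hε _ _ hz.2, p0]
        ring
      · rw [ricci_scaledMetric_succ_zero hh hV2 hε _ _ hz.2, p0]
        ring
      · have hij := hR z hz i.succ j.succ
        rw [ricci_scaledMetric_succ_succ hh hV2 hε _ _ hz.2, hbox] at hij
        rw [ricci_scaledMetric_succ_succ hh hV2 hε _ _ hz.2, hlin, hbox, pj, pj]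
        -- The two spatial Ricci tensors differ only in the quadratic coefficient, and `hquad` is
        -- that difference.
        linear_combination hij
          - partialDeriv i V (Fin.tail z) * partialDeriv j V (Fin.tail z) * hquad
    intro i j
    rw [einsteinTensor_of_ricci hRic]
    ring
  · obtain ⟨hh, hbox⟩ := key z hz
    rw [box_scaledMetric hh hV2 hε a' b' σ hz.2, hlin, hbox]
    simp

end Rescale

end EinsteinScalar

theorem corollary2 (n N : ℕ) (hNn : N = n + 1) (hN : 4 ≤ N)
    (k : WithTop ℕ∞) (hk : 2 ≤ k) (ν : ℕ)
    (κ : ℝ) (hκ : 0 < κ)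
    (J : Set ℝ) (hJ : IsOpen J) (D : Set (Fin n → ℝ)) (hD : IsOpen D)
    (ε : ℝ) (hε : ε = 1 ∨ ε = -1)
    (V : (Fin n → ℝ) → ℝ) (hV : ContDiffOn ℝ k V D) (h : TensorField n)
    (hvac : IsVacuumSolution k ν (cylinder J D) 0 (orthMetric ε V h))
    (α : ℝ) (hα : α ∈ Set.Icc (-1 : ℝ) 1)
    (γ : ℝ) (hγ : γ = α + ((N : ℝ) - 4) / ((N : ℝ) - 3) * (1 - α))
    (σ : ℝ)
    (hσ : σ = Real.sqrt (((N : ℝ) - 2) / (κ * ((N : ℝ) - 3)) * (1 - α ^ 2)) ∨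
      σ = -Real.sqrt (((N : ℝ) - 2) / (κ * ((N : ℝ) - 3)) * (1 - α ^ 2))) :
    IsEinsteinScalarSolution k ν (cylinder J D) κ (fun _ => 0)
        (blockMetric (fun x => ε * Real.exp (2 * α * V x))
          (fun x => Real.exp (-2 * γ * V x) • h x))
        (fun z => σ * V (Fin.tail z)) ∧
      ∃ h' : TensorField n,
        blockMetric (fun x => ε * Real.exp (2 * α * V x))
            (fun x => Real.exp (-2 * γ * V x) • h x) =
          orthMetric ε (fun x => α * V x) h' := by
  have hn : (3 : ℝ) ≤ n := by
    have : 3 ≤ n := by omega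
    exact_mod_cast this
  have hNr : (N : ℝ) = n + 1 := by rw [hNn]; push_cast; ring
  have hε0 : ε ≠ 0 := by rcases hε with rfl | rfl <;> norm_num
  have hm : (n : ℝ) - 2 ≠ 0 := by linarith
  rw [hNr] at hγ hσ
  -- This is the equality of $a+(n-2)b$ at $(\alpha,-\gamma)$ and at $(1,-1)$, where the value is
  -- $3-n$.
  have hγ' : ((n : ℝ) - 2) * γ = α + n - 3 := by
    rw [hγ, show (n : ℝ) + 1 - 4 = n - 3 by ring, show (n : ℝ) + 1 - 3 = n - 2 by ring]
    field_simp
    ring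
  -- Only $\sigma^2$ enters the field equations, so either sign of the root serves;
  -- $\alpha\in[-1,1]$ makes the radicand nonnegative.
  have hσ2 : κ * σ ^ 2 * ((n : ℝ) - 2) = (n - 1) * (1 - α ^ 2) := by
    have hα2 : 0 ≤ 1 - α ^ 2 := by nlinarith [hα.1, hα.2]
    have hnn : 0 ≤ ((n : ℝ) + 1 - 2) / (κ * ((n : ℝ) + 1 - 3)) * (1 - α ^ 2) :=
      mul_nonneg (div_nonneg (by linarith) (mul_nonneg hκ.le (by linarith))) hα2
    have : σ ^ 2 = ((n : ℝ) + 1 - 2) / (κ * ((n : ℝ) + 1 - 3)) * (1 - α ^ 2) := by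
      rcases hσ with rfl | rfl
      · exact Real.sq_sqrt hnn
      · rw [neg_sq, Real.sq_sqrt hnn]
    rw [this, show (n : ℝ) + 1 - 2 = n - 1 by ring, show (n : ℝ) + 1 - 3 = n - 2 by ring]
    field_simp
  have hform : blockMetric (fun x => ε * Real.exp (2 * α * V x))
      (fun x => Real.exp (-2 * γ * V x) • h x) = scaledMetric ε α (-γ) V h := by
    simp [scaledMetric]
  -- The witness is forced by $e^{-2\alpha V}h'=e^{-2\gamma V}h$.
  refine ⟨?_, fun x => Real.exp (2 * (α - γ) * V x) • h x, ?_⟩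
  · rw [hform]
    rw [orthMetric_eq_scaledMetric] at hvac
    refine isEinsteinScalarSolution_scaledMetric hk hD hε0 hV one_ne_zero hvac.1
      (fun z hz => ?_) ?_ ?_
    · obtain ⟨hs, hdet, -⟩ := hvac.1.2 z hz
      refine ricci_eq_zero_of_einsteinTensor_eq_zero ?_ hs hdet fun i j => ?_
      · push_cast
        linarith
      · simpa using hvac.2 z hz i j
    · linear_combination -hγ'
    · refine mul_right_cancel₀ hm ?_
      -- After multiplication by $n-2$, the new quadratic coefficient becomes
      -- $(n-3)^2-(n-1)\alpha^2$ by `hγ'`, and the vacuum one is $(n-2)(n-5)$; the difference is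
      -- $(n-1)(1-\alpha^2)$.
      linear_combination hσ2 + (2 * α - ((n : ℝ) - 2) * γ - (α + n - 3)) * hγ'
  · unfold orthMetric
    congr 1
    · funext x
      ring_nf
    · funext x
      rw [smul_smul, ← Real.exp_add]
      ring_nf
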